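/- **Setting.** For $l\in\{1,2\}$, subnetwork $\Xi_l$ has $n_l\ge1$ agents, an action set $\mathcal X_l\subseteq\mathbb R^{m_l}$, a type set $\Theta_l=[\underline\theta_l,\overline\theta_l]$; types have joint density $p$ on $\Theta_1\times\Theta_2$ with marginals $p_l$. Agent $i$ of $\Xi_l$ has a cost $f_{l,i}:\mathbb R^{m_1}\times\mathbb R^{m_2}\times\Theta_1\times\Theta_2\to\mathbb R$; put $f_l=\frac1{n_l}\sum_i f_{l,i}$. Assume: (i) $\mathcal X_l$ is nonempty, compact, convex; (ii) $\Theta_l$ is a compact interval; (iii) $f_1+f_2=0$; $f_{l,i}$ is convex in $x_l\in\mathbb R^{m_l}$ (for all $x_{3-l}\in\mathbb R^{m_{3-l}}$ and all types), and, for $x_{3-l}\in\mathcal X_{3-l}$, strictly convex in $x_l\in\mathcal X_l$; for $x_{3-l}\in\mathcal X_{3-l}$, $f_l$ is continuously differentiable and $\mu$-strongly convex in $x_l\in\mathcal X_l$, $\mu>0$; (iv) $f_{l,i}$ is $L_{l,j}$-Lipschitz in $x_j\in\mathbb R^{m_j}$ and, for actions in $\mathcal X_1\times\mathcal X_2$,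 $L_\theta$-Lipschitz in $\theta_j\in\Theta_j$, $j\in\{1,2\}$; (v) $p$ is $L_p$-Lipschitz in each type and $p_l>0$ on $\Theta_l$; (vi) the agents communicate over a time-varying digraph; for every $t\ge0$ and $l$, the union over $r=t,\dots,t+\mathcal R_0-1$ of the graphs induced on $\Xi_l$ is strongly connected; and for some $1\le\mathcal S_0\le\mathcal R_0$ every agent has, in each $\mathcal S_0$ consecutive steps, an in-neighbour in the other subnetwork. **Discretized game.** Choose $\underline\theta_l=\theta_l^0<\dots<\theta_l^{N_l}=\overline\theta_l$ with $\int_{\theta_l^{r-1}}^{\theta_l^r}p_l=1/N_l$ for all $r$, and let $\widetilde P(\theta_1^r,\theta_2^s)=\int_{\theta_1^{r-1}}^{\theta_1^r}\int_{\theta_2^{s-1}}^{\theta_2^s}p$. A strategy of $\Xi_l$ is $\sigma_l=(\sigma_l^1,\dots,\sigma_l^{N_l})\in\mathbb R^{N_lm_l}$. Let $\widetilde U_l(\sigma_1,\sigma_2,\theta_l^r)$ (resp. $\widetilde U_{l,i}$) be the conditional expectation of $f_l$ (resp. $f_{l,i}$) given $\theta_l=\theta_l^r$ under $\widetilde P$,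 and $E\widetilde U(\sigma_1,\sigma_2)=\frac1{N_1}\sum_r\widetilde U_1(\sigma_1,\sigma_2,\theta_1^r)$. A pair $(\sigma_1^*,\sigma_2^*)$ with $\sigma_l^{*r}\in\mathcal X_l$ is a DBNE if each $\sigma_l^{*r}$ minimizes $\widetilde U_l(\cdot,\theta_l^r)$ over $\mathcal X_l$ in the action at $\theta_l^r$, everything else being fixed. **Algorithm.** Fix $E_l>L_{l,l}$, $1\le d_l\le N_lm_l$, $\mathcal R=\max_l\mathcal R_0\lceil N_lm_l/d_l\rceil$, $\eta>0$, and $x_{l0}\in\mathcal X_l^{N_l}$. Let $H_l(x)=E_l\|x-\Pi_{\mathcal X_l}(x)\|$ and $h_l(x)=E_l\frac{x-\Pi_{\mathcal X_l}(x)}{\|x-\Pi_{\mathcal X_l}(x)\|}$ ($h_l=0$ on $\mathcal X_l$). Entry $k$ of the vectors of $\Xi_l$ is *sent* at time $t\in\{q\mathcal R_0+1,\dots,(q+1)\mathcal R_0\}$ iff $k\equiv qd_l+b \pmod{N_lm_l}$ for some $b\in\{1,\dots,d_l\}$ (time $0$ belongs to the window $q=0$). For each entry $k$ and time $t$, use the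 edges within $\Xi_l$ at time $t$, together with self-loops, if $k$ is sent, and self-loops only otherwise: $A_{l,k}(t)$ is the row-stochastic matrix of uniform averaging over in-neighbours, and $B_{l,k}(t)$ the column-stochastic matrix of uniform splitting among out-neighbours. Start with $\sigma_{l,i}(0)=s_{l,i}(0)=x_{l0}$ and $\hat\zeta_{l,i}(0)=x_{3-l,0}$. At each time, $[\hat\sigma_{l,i}(t)]_k=\sum_j[A_{l,k}(t)]_{ij}[\sigma_{l,j}(t)]_k$; for $t\ge1$, $[\hat\zeta_{l,i}(t)]_k$ is the mean of $[\hat\sigma_{3-l,j}(t)]_k$ over the in-neighbours $j$ of the agent in $\Xi_{3-l}$ if there are any and $k$ is sent, and $[\hat\zeta_{l,i}(t-1)]_k$ otherwise. Let $g_{l,i}^r(t)=\frac1{N_l}\big(w_{l,i}^r(t)+h_l(\sigma_{l,i}^r(t))\big)$, where $w^r_{l,i}(t)$ is any subgradient at $\sigma_{l,i}^r(t)$ of $\widetilde U_{l,i}(\cdot,\theta_l^r)$ as a function of the own action at $\theta_l^r$, the rival playing $\hat\zeta_{l,i}(t)$. With $z_{l,k}=\mathrm{col}([\sigma_{l,1}]_k,\dots,[\sigma_{l,n_l}]_k,[s_{l,1}]_k,\dots,[s_{l,n_l}]_k)$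 and $q=\lfloor t/\mathcal R\rfloor$, $$z_{l,k}(t+1)=\begin{bmatrix}A_{l,k}(t)&0\\ I-A_{l,k}(t)&B_{l,k}(t)\end{bmatrix}z_{l,k}(t)+1_{\{t\bmod\mathcal R=\mathcal R-1\}}\Big(\eta\begin{bmatrix}0&I\\0&-I\end{bmatrix}z_{l,k}(q\mathcal R)-\alpha(q)\begin{bmatrix}([g_{l,i}(q\mathcal R)]_k)_{i}\\0\end{bmatrix}\Big).$$ Let $\bar\sigma_l(t)=\frac1{n_l}\sum_i(\sigma_{l,i}(t)+s_{l,i}(t))$, let $\bar H_l(\sigma_l)=\frac1{N_l}\sum_rH_l(\sigma_l^r)$, and for $T\ge\mathcal R$ let $T_0=\lfloor T/\mathcal R\rfloor$. **Theorem.** Take $\alpha(q)=1/\sqrt q$ for $q\ge1$ and any $\alpha(0)>0$. There is $\bar\eta>0$, depending only on $n_l,m_l,N_l,d_l,\mathcal R_0$, such that for every $\eta\in(0,\bar\eta)$, under the above assumptions, the algorithm attains the rate $O(\ln T/\sqrt T)$: there is a constant $C$ (independent of $T$ and of the choice of subgradients) such that, for every DBNE $(\sigma_1^*,\sigma_2^*)$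 and every integer $T\ge\max\{2,\mathcal R\}$, $$\min_{1\le q\le T_0}E\widetilde U(\bar\sigma_1(q\mathcal R),\sigma_2^*)-E\widetilde U(\sigma_1^*,\sigma_2^*)\le C\frac{\ln T}{\sqrt T},\qquad E\widetilde U(\sigma_1^*,\sigma_2^*)-\max_{1\le q\le T_0}E\widetilde U(\sigma_1^*,\bar\sigma_2(q\mathcal R))\le C\frac{\ln T}{\sqrt T},$$ and, the iterates not being confined to the action sets, these gaps with the penalties included satisfy the two-sided bounds $$\Big|\min_{1\le q\le T_0}\big(E\widetilde U(\bar\sigma_1(q\mathcal R),\sigma_2^*)+\bar H_1(\bar\sigma_1(q\mathcal R))\big)-E\widetilde U(\sigma_1^*,\sigma_2^*)\Big|\le C\frac{\ln T}{\sqrt T},$$ $$\Big|E\widetilde U(\sigma_1^*,\sigma_2^*)-\max_{1\le q\le T_0}\big(E\widetilde U(\sigma_1^*,\bar\sigma_2(q\mathcal R))-\bar H_2(\bar\sigma_2(q\mathcal R))\big)\Big|\le C\frac{\ln T}{\sqrt T}.$$ -/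

import Mathlib

open Finset

noncomputable section

namespace BayesGame

/-- Sizes: subnetwork `l` has `n l` agents, actions in `ℝ^(m l)`, `N l` discrete types, and sends
`d l` of the `N l * m l` entries of a strategy vector in each communication window of length `R₀`. -/
structure Sizes where
  n : Fin 2 → ℕ
  m : Fin 2 → ℕ
  N : Fin 2 → ℕ
  d : Fin 2 → ℕ
  R₀ : ℕ
  n_pos : ∀ l, 0 < n l
  N_pos : ∀ l, 0 < N l
  d_pos : ∀ l, 0 < d l
  d_le : ∀ l, d l ≤ N l * m l
  R₀_pos : 0 < R₀

/-- Period length `max_l R₀ ⌈N_l m_l / d_l⌉`. -/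
def Sizes.R (S : Sizes) : ℕ :=
  max (S.R₀ * ⌈(S.N 0 * S.m 0 : ℚ) / S.d 0⌉₊) (S.R₀ * ⌈(S.N 1 * S.m 1 : ℚ) / S.d 1⌉₊)

/-- Action space `ℝ^(m l)`. -/
abbrev Act (S : Sizes) (l : Fin 2) : Type := EuclideanSpace ℝ (Fin (S.m l))

/-- Strategies of the discretized game, as vectors in `ℝ^(N l * m l)`: one point of the action space
for each discrete type. -/
abbrev Strat (S : Sizes) (l : Fin 2) : Type := Fin (S.N l) → Act S l

/-- Agents of the whole network: `⟨l, i⟩` is agent `i` of subnetwork `l`. -/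
abbrev Agent (S : Sizes) : Type := Σ l : Fin 2, Fin (S.n l)

/-- The data of a subnetwork zero-sum Bayesian game. The agents' cost functions are given at all
points of `ℝ^(m 0) × ℝ^(m 1)`, since the algorithm evaluates their subgradients outside the action
sets. -/
structure Game (S : Sizes) where
  /-- action sets -/
  X : ∀ l, Set (Act S l)
  /-- type sets `[lo l, hi l]` -/
  lo : Fin 2 → ℝ
  hi : Fin 2 → ℝ
  /-- joint density of the types -/
  p : (Fin 2 → ℝ) → ℝ
  /-- cost function of agent `i` of subnetwork `l` -/
  f : ∀ l, Fin (S.n l) → (∀ j, Act S j) → (Fin 2 → ℝ) → ℝ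

variable {S : Sizes}

namespace Game

/-- The set of type profiles `Θ_1 × Θ_2`. -/
def Types (G : Game S) : Set (Fin 2 → ℝ) := Set.univ.pi fun l => Set.Icc (G.lo l) (G.hi l)

/-- The set of action profiles `X_1 × X_2`. -/
def Actions (G : Game S) : Set (∀ l, Act S l) := Set.univ.pi G.X

/-- Cost function of a subnetwork: the average of the cost functions of its agents. -/
def cost (G : Game S) (l : Fin 2) (x : ∀ j, Act S j) (θ : Fin 2 → ℝ) : ℝ :=
  (1 / (S.n l : ℝ)) * ∑ i, G.f l i x θ

/-- Marginal density of the type of subnetwork `l`; `l + 1` is the other subnetwork. -/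
def marginal (G : Game S) (l : Fin 2) (x : ℝ) : ℝ :=
  ∫ y in Set.Icc (G.lo (l + 1)) (G.hi (l + 1)), G.p (Function.update (fun _ => y) l x)

/-- The standing assumptions on the game, with the Lipschitz constants `L l j` of the costs of
subnetwork `l` in the action of subnetwork `j`. -/
structure Assumptions (G : Game S) (L : Fin 2 → Fin 2 → NNReal) : Prop where
  /-- the action sets are nonempty, compact and convex -/
  nonempty : ∀ l, (G.X l).Nonempty
  compact : ∀ l, IsCompact (G.X l)
  convex : ∀ l, Convex ℝ (G.X l)
  /-- the type sets are compact intervals -/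
  lo_le_hi : ∀ l, G.lo l ≤ G.hi l
  /-- zero sum -/
  zero_sum : ∀ x, ∀ θ ∈ G.Types, G.cost 0 x θ + G.cost 1 x θ = 0
  /-- each agent's cost is convex in the own action, strictly on the action set -/
  convex_own : ∀ l i x, ∀ θ ∈ G.Types,
    ConvexOn ℝ Set.univ fun y : Act S l => G.f l i (Function.update x l y) θ
  strictConvex_own : ∀ l i, ∀ x ∈ G.Actions, ∀ θ ∈ G.Types,
    StrictConvexOn ℝ (G.X l) fun y : Act S l => G.f l i (Function.update x l y) θ
  /-- each subnetwork's cost is continuously differentiable and strongly convex in the own action -/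
  contDiff_own : ∀ l, ∀ x ∈ G.Actions, ∀ θ ∈ G.Types,
    ContDiffOn ℝ 1 (fun y : Act S l => G.cost l (Function.update x l y) θ) (G.X l)
  strongConvex_own : ∃ μ : ℝ, 0 < μ ∧ ∀ l, ∀ x ∈ G.Actions, ∀ θ ∈ G.Types,
    StrongConvexOn (G.X l) μ fun y : Act S l => G.cost l (Function.update x l y) θ
  /-- each agent's cost is Lipschitz in both actions and in both types -/
  lipschitz_action : ∀ l i j x, ∀ θ ∈ G.Types,
    LipschitzWith (L l j) fun y : Act S j => G.f l i (Function.update x j y) θ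
  lipschitz_type : ∃ Lθ : NNReal, ∀ l i j, ∀ x ∈ G.Actions, ∀ θ ∈ G.Types,
    LipschitzOnWith Lθ (fun a => G.f l i x (Function.update θ j a)) (Set.Icc (G.lo j) (G.hi j))
  /-- `p` is a probability density, Lipschitz in each type, with positive marginals -/
  density_nonneg : ∀ θ ∈ G.Types, 0 ≤ G.p θ
  density_total : ∫ θ in G.Types, G.p θ = 1
  density_lipschitz : ∃ Lp : NNReal, ∀ l, ∀ θ ∈ G.Types,
    LipschitzOnWith Lp (fun a => G.p (Function.update θ l a)) (Set.Icc (G.lo l) (G.hi l))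
  marginal_pos : ∀ l, ∀ a ∈ Set.Icc (G.lo l) (G.hi l), 0 < G.marginal l a

end Game

/-! ### Discretization -/

/-- Discretization points: `pts l 0 < pts l 1 < … < pts l (N l)`. -/
abbrev Points (S : Sizes) : Type := ∀ l, Fin (S.N l + 1) → ℝ

/-- The `r`-th discrete type is the right end point of the `r`-th interval. -/
def typeAt (pts : Points S) (l : Fin 2) (r : Fin (S.N l)) : ℝ := pts l r.succ

/-- Joint distribution of the discrete types. -/
def prob (G : Game S) (pts : Points S) (κ : ∀ l, Fin (S.N l)) : ℝ :=
  ∫ θ in Set.univ.pi fun l => Set.Ioc (pts l (κ l).castSucc) (pts l (κ l).succ), G.p θ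

/-- Marginal distribution of the discrete types. -/
def probMarginal (G : Game S) (pts : Points S) (l : Fin 2) (r : Fin (S.N l)) : ℝ :=
  ∑ κ : (∀ j, Fin (S.N j)) with κ l = r, prob G pts κ

/-- The points cut each type interval into pieces of equal probability. -/
structure IsDiscretization (G : Game S) (pts : Points S) : Prop where
  strictMono : ∀ l, StrictMono (pts l)
  first : ∀ l, pts l 0 = G.lo l
  last : ∀ l, pts l (Fin.last (S.N l)) = G.hi l
  uniform : ∀ l r, probMarginal G pts l r = 1 / (S.N l : ℝ)

/-- Conditional expectation, given that the type of subnetwork `l` is its `r`-th discrete type, of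
the cost `F` under the strategy profile `σ` in the discretized game. -/
def expCost (G : Game S) (pts : Points S) (F : (∀ j, Act S j) → (Fin 2 → ℝ) → ℝ)
    (l : Fin 2) (r : Fin (S.N l)) (σ : ∀ j, Strat S j) : ℝ :=
  ∑ κ : (∀ j, Fin (S.N j)) with κ l = r,
    F (fun j => σ j (κ j)) (fun j => typeAt pts j (κ j)) * (prob G pts κ / probMarginal G pts l r)

/-- The profile `σ` with the action of subnetwork `l` at its `r`-th type replaced by `y`. -/
def setAction (σ : ∀ j, Strat S j) (l : Fin 2) (r : Fin (S.N l)) (y : Act S l) : ∀ j, Strat S j :=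
  Function.update σ l (Function.update (σ l) r y)

/-- Bayesian Nash equilibrium of the discretized game. -/
def IsDBNE (G : Game S) (pts : Points S) (σ : ∀ j, Strat S j) : Prop :=
  ∀ l r, σ l r ∈ G.X l ∧ ∀ y ∈ G.X l,
    expCost G pts (G.cost l) l r σ ≤ expCost G pts (G.cost l) l r (setAction σ l r y)

/-- Expected zero-sum payoff of the discretized game (the expected cost of the first subnetwork). -/
def payoff (G : Game S) (pts : Points S) (σ : ∀ j, Strat S j) : ℝ :=
  (1 / (S.N 0 : ℝ)) * ∑ r, expCost G pts (G.cost 0) 0 r σ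

/-! ### Penalty -/

/-- Euclidean projection onto `C` (meaningful for nonempty closed convex `C`). -/
def proj {m : ℕ} (C : Set (EuclideanSpace ℝ (Fin m))) (x : EuclideanSpace ℝ (Fin m)) :
    EuclideanSpace ℝ (Fin m) :=
  Classical.epsilon fun y => y ∈ C ∧ ∀ z ∈ C, ‖x - y‖ ≤ ‖x - z‖

/-- Penalty function `H_l`. -/
def penalty (G : Game S) (E : Fin 2 → ℝ) (l : Fin 2) (x : Act S l) : ℝ :=
  E l * ‖x - proj (G.X l) x‖

/-- The subgradient `h_l` of the penalty function; it is zero on the action set. -/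
def penaltyGrad (G : Game S) (E : Fin 2 → ℝ) (l : Fin 2) (x : Act S l) : Act S l :=
  (E l / ‖x - proj (G.X l) x‖) • (x - proj (G.X l) x)

/-- Average penalty of a strategy of subnetwork `l`. -/
def meanPenalty (G : Game S) (E : Fin 2 → ℝ) (l : Fin 2) (σ : Strat S l) : ℝ :=
  (1 / (S.N l : ℝ)) * ∑ r, penalty G E l (σ r)

/-- `g` is a subgradient of `φ` at `x`. -/
def IsSubgradient {m : ℕ} (φ : EuclideanSpace ℝ (Fin m) → ℝ) (x g : EuclideanSpace ℝ (Fin m)) :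
    Prop :=
  ∀ y, φ x + inner ℝ (y - x) g ≤ φ y

/-! ### Network and compressed communication -/

/-- A time-varying digraph on all agents: `net t u v` says that `u` sends to `v` at time `t`. -/
abbrev Network (S : Sizes) : Type := ℕ → Agent S → Agent S → Prop

/-- Each subnetwork is `R₀`-jointly strongly connected, and for some `S₀ ≤ R₀` each agent hears from
the other subnetwork at least once in any `S₀` consecutive steps. -/
structure NetworkAssumptions (net : Network S) : Prop where
  joint : ∀ (t : ℕ) (l : Fin 2) (i j : Fin (S.n l)),
    Relation.ReflTransGen
      (fun a b : Fin (S.n l) => ∃ τ, t ≤ τ ∧ τ < t + S.R₀ ∧ net τ ⟨l, a⟩ ⟨l, b⟩) i j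
  cross : ∃ S₀ : ℕ, 0 < S₀ ∧ S₀ ≤ S.R₀ ∧ ∀ (t : ℕ) (l : Fin 2) (i : Fin (S.n l)),
    ∃ τ, t ≤ τ ∧ τ < t + S₀ ∧ ∃ (j : Fin 2) (i' : Fin (S.n j)), j ≠ l ∧ net τ ⟨j, i'⟩ ⟨l, i⟩

/-- Coordinate `c` at the `r`-th type is nonempty in the sparsified vectors of subnetwork `l` at
time `t`. For `q R₀ + 1 ≤ t ≤ (q + 1) R₀` the `d l` entries sent are those with (zero-based)
positions `q d, …, (q + 1) d - 1` modulo `N l * m l`; time `0` is put in the first window. -/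
def Sent (S : Sizes) (l : Fin 2) (r : Fin (S.N l)) (c : Fin (S.m l)) (t : ℕ) : Prop :=
  ∃ b < S.d l, ((t - 1) / S.R₀ * S.d l + b) % (S.N l * S.m l) = (r : ℕ) * S.m l + c

open Classical in
/-- In-neighbours, within subnetwork `l`, of agent `i` for the given entry, including `i`. -/
def inNbrs (net : Network S) (l : Fin 2) (r : Fin (S.N l)) (c : Fin (S.m l)) (t : ℕ)
    (i : Fin (S.n l)) : Finset (Fin (S.n l)) :=
  Finset.univ.filter fun j => j = i ∨ (net t ⟨l, j⟩ ⟨l, i⟩ ∧ Sent S l r c t)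

open Classical in
/-- Out-neighbours, within subnetwork `l`, of agent `i` for the given entry, including `i`. -/
def outNbrs (net : Network S) (l : Fin 2) (r : Fin (S.N l)) (c : Fin (S.m l)) (t : ℕ)
    (i : Fin (S.n l)) : Finset (Fin (S.n l)) :=
  Finset.univ.filter fun j => j = i ∨ (net t ⟨l, i⟩ ⟨l, j⟩ ∧ Sent S l r c t)

/-- The in-neighbour matrix (row stochastic): agents average over their in-neighbours. -/
def matA (net : Network S) (l : Fin 2) (r : Fin (S.N l)) (c : Fin (S.m l)) (t : ℕ) :
    Matrix (Fin (S.n l)) (Fin (S.n l)) ℝ :=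
  Matrix.of fun i j =>
    if j ∈ inNbrs net l r c t i then 1 / ((inNbrs net l r c t i).card : ℝ) else 0

/-- The out-neighbour matrix (column stochastic): agents split their surplus equally among their
out-neighbours. -/
def matB (net : Network S) (l : Fin 2) (r : Fin (S.N l)) (c : Fin (S.m l)) (t : ℕ) :
    Matrix (Fin (S.n l)) (Fin (S.n l)) ℝ :=
  Matrix.of fun i j =>
    if i ∈ outNbrs net l r c t j then 1 / ((outNbrs net l r c t j).card : ℝ) else 0

/-- The block matrix of the joint update of states and surpluses. -/
def matM (net : Network S) (l : Fin 2) (r : Fin (S.N l)) (c : Fin (S.m l)) (t : ℕ) :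
    Matrix (Fin (S.n l) ⊕ Fin (S.n l)) (Fin (S.n l) ⊕ Fin (S.n l)) ℝ :=
  Matrix.fromBlocks (matA net l r c t) 0 (1 - matA net l r c t) (matB net l r c t)

/-- The block matrix `F` that feeds surpluses back into the states. -/
def matF (S : Sizes) (l : Fin 2) :
    Matrix (Fin (S.n l) ⊕ Fin (S.n l)) (Fin (S.n l) ⊕ Fin (S.n l)) ℝ :=
  Matrix.fromBlocks 0 1 0 (-1)

open Classical in
/-- Agents of subnetwork `j` from which agent `i` of subnetwork `l ≠ j` receives the given entry. -/
def crossNbrs (net : Network S) (l : Fin 2) (i : Fin (S.n l)) (j : Fin 2) (r : Fin (S.N j))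
    (c : Fin (S.m j)) (t : ℕ) : Finset (Fin (S.n j)) :=
  Finset.univ.filter fun i' => net t ⟨j, i'⟩ ⟨l, i⟩ ∧ Sent S j r c t

/-! ### The algorithm -/

/-- Stepsize `α(q) = 1 / √q` for `q ≥ 1`, with a first step `a₀`. -/
def stepsize (a₀ : ℝ) (q : ℕ) : ℝ := if q = 0 then a₀ else 1 / Real.sqrt q

/-- The sequences produced by the algorithm: states `σ`, surpluses `s`, estimates `ζ` and
subgradients `w` of agent `i` of subnetwork `l` at time `t`. The estimate `ζ l i t j` of the
strategy of subnetwork `j` is used for `j ≠ l` only. -/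
structure Trajectory (S : Sizes) where
  σ : ∀ l, Fin (S.n l) → ℕ → Strat S l
  s : ∀ l, Fin (S.n l) → ℕ → Strat S l
  ζ : ∀ l, Fin (S.n l) → ℕ → ∀ j, Strat S j
  w : ∀ l, Fin (S.n l) → ℕ → Strat S l

namespace Trajectory

/-- Estimate of an agent's own subnetwork from the compressed messages. -/
def est (Z : Trajectory S) (net : Network S) (l : Fin 2) (i : Fin (S.n l)) (t : ℕ)
    (r : Fin (S.N l)) (c : Fin (S.m l)) : ℝ :=
  ∑ j, matA net l r c t i j * Z.σ l j t r c

/-- The strategy profile as seen by agent `i` of subnetwork `l`: own state, estimated rival. -/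
def view (Z : Trajectory S) (l : Fin 2) (i : Fin (S.n l)) (t : ℕ) : ∀ j, Strat S j :=
  Function.update (Z.ζ l i t) l (Z.σ l i t)

/-- The update direction `g` of an agent, at its `r`-th type. -/
def grad (Z : Trajectory S) (G : Game S) (E : Fin 2 → ℝ) (l : Fin 2) (i : Fin (S.n l)) (t : ℕ)
    (r : Fin (S.N l)) : Act S l :=
  (1 / (S.N l : ℝ)) • (Z.w l i t r + penaltyGrad G E l (Z.σ l i t r))

/-- States and surpluses of all agents of a subnetwork, for one entry. -/
def z (Z : Trajectory S) (l : Fin 2) (r : Fin (S.N l)) (c : Fin (S.m l)) (t : ℕ) :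
    Fin (S.n l) ⊕ Fin (S.n l) → ℝ :=
  Sum.elim (fun i => Z.σ l i t r c) (fun i => Z.s l i t r c)

/-- Average state of a subnetwork. -/
def avg (Z : Trajectory S) (l : Fin 2) (t : ℕ) : Strat S l :=
  (1 / (S.n l : ℝ)) • ∑ i, (Z.σ l i t + Z.s l i t)

/-- `Z` is a run of the algorithm from the initial strategies `x₀`, with penalty constants `E`,
surplus parameter `η` and first step `a₀`. -/
structure IsRun (Z : Trajectory S) (G : Game S) (pts : Points S) (net : Network S)
    (E : Fin 2 → ℝ) (η a₀ : ℝ) (x₀ : ∀ l, Strat S l) : Prop where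
  init_σ : ∀ l i, Z.σ l i 0 = x₀ l
  init_s : ∀ l i, Z.s l i 0 = x₀ l
  init_ζ : ∀ l i j, j ≠ l → Z.ζ l i 0 j = x₀ j
  estimate : ∀ l i j, j ≠ l → ∀ (t : ℕ) (r : Fin (S.N j)) (c : Fin (S.m j)),
    Z.ζ l i (t + 1) j r c =
      if (crossNbrs net l i j r c (t + 1)).card ≠ 0 then
        ∑ i' ∈ crossNbrs net l i j r c (t + 1),
          1 / ((crossNbrs net l i j r c (t + 1)).card : ℝ) * Z.est net j i' (t + 1) r c
      else Z.ζ l i t j r c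
  subgradient : ∀ l i t r,
    IsSubgradient (fun y => expCost G pts (G.f l i) l r (setAction (Z.view l i t) l r y))
      (Z.σ l i t r) (Z.w l i t r)
  update : ∀ (l : Fin 2) (r : Fin (S.N l)) (c : Fin (S.m l)) (t : ℕ),
    Z.z l r c (t + 1) = (matM net l r c t).mulVec (Z.z l r c t) +
      if t % S.R = S.R - 1 then
        η • (matF S l).mulVec (Z.z l r c (S.R * (t / S.R))) -
          stepsize a₀ (t / S.R) • Sum.elim (fun i => Z.grad G E l i (S.R * (t / S.R)) r c) 0
      else 0

/-- `min_{1 ≤ q ≤ ⌊T/R⌋}` of the payoff when the first subnetwork plays its average state at time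
`q R` and the second one its equilibrium strategy; `pen` is `0`, or `1` to add the penalty. -/
def payoffMin (Z : Trajectory S) (G : Game S) (pts : Points S) (E : Fin 2 → ℝ)
    (σstar : ∀ l, Strat S l) (pen : ℝ) (T : ℕ) : ℝ :=
  sInf ((fun q : ℕ => payoff G pts (Function.update σstar 0 (Z.avg 0 (q * S.R))) +
    pen * meanPenalty G E 0 (Z.avg 0 (q * S.R))) '' Set.Icc 1 (T / S.R))

/-- `max_{1 ≤ q ≤ ⌊T/R⌋}` of the payoff when the second subnetwork plays its average state at time
`q R` and the first one its equilibrium strategy; `pen` is `0`, or `1` to subtract the penalty. -/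
def payoffMax (Z : Trajectory S) (G : Game S) (pts : Points S) (E : Fin 2 → ℝ)
    (σstar : ∀ l, Strat S l) (pen : ℝ) (T : ℕ) : ℝ :=
  sSup ((fun q : ℕ => payoff G pts (Function.update σstar 1 (Z.avg 1 (q * S.R))) -
    pen * meanPenalty G E 1 (Z.avg 1 (q * S.R))) '' Set.Icc 1 (T / S.R))

end Trajectory

end BayesGame

end

/-! The proof combines a consensus estimate, by which all disagreement in the network is O(1/√q) at
period q, with the distance-to-equilibrium argument for subgradient steps in a zero-sum game with an
exact penalty.

Consensus. Sample the recursion at the starts of periods. The average of states plus surpluses is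
conserved by mixing and feedback, so it moves exactly by a step along the mean update direction
(`avg_succ`). For one entry, let y be the deviation of the states from this average and s the
surpluses, so that Σy + Σs = 0. Let φ be the uniform probability vector transported by the
column-stochastic matrices, and write s = e - (Σy) φ, where Σe = 0. The feedback η s then pulls y
towards zero at rate η κ, because n φ ≥ κ > 0 entrywise. The spread of y contracts under products of
the A's and e under products of the B's, because any two periods contain a whole window in which the
entry is sent and the subnetwork is jointly connected. The couplings between ‖y‖, spread and e are
of order η, except the effect of the spread on e; as that one acts in a single direction, a weighted
sum of the three contracts for small η (`exists_weights_of_small_gain`). All constants involved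
depend on the sizes only, hence so does the bound on η. The forcing is a bounded direction times
α(q), so y = O(1/√q) (`exists_surplusConsensus`). An estimate of the rival dates from at most two
periods earlier, during which the average drifts by O(1/√q); thus every agent's view is within
O(1/√q) of the profile of averages (`exists_norm_view_sub_avg_le`).

Optimization. Since E_l > L_ll, the penalized loss `gap` of a subnetwork against an equilibrium is
nonnegative even outside the action set (`gap_nonneg`). By the zero-sum property the two gaps add up
to the gains from moving each side to its equilibrium strategy at the current profile
(`sum_gap_eq`), and subgradient inequalities bound these by inner products with the update
directions, up to O(1/√q). Telescoping the squared distance to the equilibrium gives Σ α(q) · gaps =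
O(Σ 1/(q+1)), which is logarithmic, while the weights α(1), …, α(K) add up to at least √K; so the
least gap is O(ln T/√T). Nonnegativity of gaps gives the other half of the two-sided bounds, and
nonnegativity of penalties the bounds without them. -/

noncomputable section

namespace BayesGame

/-! ### Products of stochastic matrices -/

section Products

set_option linter.unusedSectionVars false

variable {ι : Type*} [Fintype ι] [DecidableEq ι]

/-- The backward product `A (t + k - 1) * ⋯ * A t`. -/
def prodFrom (A : ℕ → Matrix ι ι ℝ) (t : ℕ) : ℕ → Matrix ι ι ℝ
  | 0 => 1
  | k + 1 => A (t + k) * prodFrom A t k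

/-- The lower left block of the product of the block matrices `[A 0; 1 - A, B]`. -/
def lowerFrom (A B : ℕ → Matrix ι ι ℝ) (t : ℕ) : ℕ → Matrix ι ι ℝ
  | 0 => 0
  | k + 1 => (1 - A (t + k)) * prodFrom A t k + B (t + k) * lowerFrom A B t k

theorem prodFrom_mem {M : Submonoid (Matrix ι ι ℝ)} {A : ℕ → Matrix ι ι ℝ} (h : ∀ t, A t ∈ M)
    (t k : ℕ) : prodFrom A t k ∈ M := by
  induction k with
  | zero => exact M.one_mem
  | succ k ih => exact M.mul_mem (h _) ih

theorem prodFrom_add (A : ℕ → Matrix ι ι ℝ) (t a b : ℕ) :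
    prodFrom A t (a + b) = prodFrom A (t + a) b * prodFrom A t a := by
  induction b with
  | zero => simp [prodFrom]
  | succ b ih => rw [← add_assoc, prodFrom, ih, prodFrom, Matrix.mul_assoc, add_assoc]

theorem prodFrom_period (A : ℕ → Matrix ι ι ℝ) (R q k : ℕ) :
    prodFrom (fun q => prodFrom A (q * R) R) q k = prodFrom A (q * R) (k * R) := by
  induction k with
  | zero => simp [prodFrom]
  | succ k ih =>
    rw [prodFrom, ih, Nat.succ_mul, prodFrom_add A (q * R) (k * R) R, ← Nat.add_mul]

theorem prodFrom_succ_left (A : ℕ → Matrix ι ι ℝ) (t k : ℕ) :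
    prodFrom A t (k + 1) = prodFrom A (t + 1) k * A t := by
  rw [add_comm k 1, prodFrom_add]; simp [prodFrom]

/-- A path of k steps and weight at least δ ^ k is prolonged by one edge: in the matrix product,
keep only the term through i. -/
theorem pow_succ_le_prodFrom {A : ℕ → Matrix ι ι ℝ} {δ : ℝ} (hδ : 0 ≤ δ)
    (hA : ∀ t i j, 0 ≤ A t i j) {t k : ℕ} {i i' j : ι} (h : δ ^ k ≤ prodFrom A t k i j)
    (h' : δ ≤ A (t + k) i' i) : δ ^ (k + 1) ≤ prodFrom A t (k + 1) i' j := by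
  have hnn : ∀ k i j, 0 ≤ prodFrom A t k i j := by
    intro k
    induction k with
    | zero => intro i j; simp only [prodFrom, Matrix.one_apply]; split_ifs <;> norm_num
    | succ k ih =>
      intro i j
      simp only [prodFrom, Matrix.mul_apply]
      exact sum_nonneg fun x _ => mul_nonneg (hA _ _ _) (ih _ _)
  calc δ ^ (k + 1) = δ * δ ^ k := pow_succ' _ _
    _ ≤ A (t + k) i' i * prodFrom A t k i j :=
        mul_le_mul h' h (pow_nonneg hδ _) (hA _ _ _)
    _ ≤ ∑ x, A (t + k) i' x * prodFrom A t k x j :=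
        single_le_sum (f := fun x => A (t + k) i' x * prodFrom A t k x j)
          (fun x _ => mul_nonneg (hA _ _ _) (hnn _ _ _)) (mem_univ i)
    _ = prodFrom A t (k + 1) i' j := by simp only [prodFrom, Matrix.mul_apply]

theorem pow_add_le_prodFrom {A : ℕ → Matrix ι ι ℝ} {δ : ℝ} (hδ : 0 ≤ δ)
    (hA : ∀ t i j, 0 ≤ A t i j) (hd : ∀ t i, δ ≤ A t i i) {t k : ℕ} {i j : ι}
    (h : δ ^ k ≤ prodFrom A t k i j) (b : ℕ) : δ ^ (k + b) ≤ prodFrom A t (k + b) i j := by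
  induction b with
  | zero => exact h
  | succ b ih => exact pow_succ_le_prodFrom hδ hA ih (hd _ _)

theorem pow_le_prodFrom_diag {A : ℕ → Matrix ι ι ℝ} {δ : ℝ} (hδ : 0 ≤ δ)
    (hA : ∀ t i j, 0 ≤ A t i j) (hd : ∀ t i, δ ≤ A t i i) (t k : ℕ) (i : ι) :
    δ ^ k ≤ prodFrom A t k i i := by
  have := pow_add_le_prodFrom hδ hA hd (t := t) (k := 0) (i := i) (j := i) (by simp [prodFrom]) k
  simpa using this

theorem exists_edge_of_reflTransGen {α : Type*} {r : α → α → Prop} {s : Set α} {a b : α}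
    (h : Relation.ReflTransGen r a b) (ha : a ∈ s) (hb : b ∉ s) :
    ∃ x y, x ∈ s ∧ y ∉ s ∧ r x y := by
  induction h with
  | refl => exact absurd ha hb
  | @tail y z _ hyz ih =>
    by_cases hy : y ∈ s
    · exact ⟨y, z, hy, hb, hyz⟩
    · exact ih hy

/-- If the graphs of the entries of size at least `δ` are jointly strongly connected over every
interval of length `W`, then products of `W * card ι` matrices are entrywise positive. -/
theorem pow_le_prodFrom_of_connected {A : ℕ → Matrix ι ι ℝ} {δ : ℝ} (hδ : 0 ≤ δ)
    (hA : ∀ t i j, 0 ≤ A t i j) (hd : ∀ t i, δ ≤ A t i i) {W : ℕ}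
    (hconn : ∀ t i j,
      Relation.ReflTransGen (fun a b => ∃ τ, t ≤ τ ∧ τ < t + W ∧ δ ≤ A τ b a) i j)
    (t : ℕ) (i j : ι) :
    δ ^ (W * Fintype.card ι) ≤ prodFrom A t (W * Fintype.card ι) i j := by
  classical
  -- The vertices reached from j after k steps. Self-loops make the set increase with k, and while
  -- it is not everything, joint connectivity supplies an edge leaving it, hence a new vertex, in
  -- each block of W steps.
  let s : ℕ → Finset ι := fun k => univ.filter fun i => δ ^ k ≤ prodFrom A t k i j
  have mem : ∀ k i, i ∈ s k ↔ δ ^ k ≤ prodFrom A t k i j := fun k i => by simp [s]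
  have hj : ∀ k, j ∈ s k := fun k => (mem _ _).2 (pow_le_prodFrom_diag hδ hA hd _ _ _)
  have mono : ∀ {k k'}, k ≤ k' → s k ⊆ s k' := by
    intro k k' h i hi
    obtain ⟨b, rfl⟩ := Nat.exists_eq_add_of_le h
    exact (mem _ _).2 (pow_add_le_prodFrom hδ hA hd ((mem _ _).1 hi) b)
  have key : ∀ m, s (W * m) = univ ∨ m + 1 ≤ (s (W * m)).card := by
    intro m
    induction m with
    | zero => right; simpa using card_pos.2 ⟨j, hj _⟩
    | succ m ih =>
      have hle : W * m ≤ W * (m + 1) := Nat.mul_le_mul_left _ (Nat.le_succ m)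
      by_cases hu : s (W * m) = univ
      · left
        exact univ_subset_iff.1 (hu ▸ mono hle)
      · right
        have ih := ih.resolve_left hu
        obtain ⟨i, hi⟩ : ∃ i, i ∉ s (W * m) := by
          by_contra! h; exact hu (eq_univ_iff_forall.2 h)
        obtain ⟨x, y, hx, hy, τ, h1, h2, h3⟩ :=
          exists_edge_of_reflTransGen (s := {i | i ∈ s (W * m)}) (hconn (t + W * m) j i) (hj _) hi
        obtain ⟨k, rfl⟩ : ∃ k, τ = t + k := ⟨τ - t, by omega⟩
        have hxk : x ∈ s k := mono (by omega) hx
        have hyk : y ∈ s (W * (m + 1)) :=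
          mono (by rw [Nat.mul_succ]; omega)
            ((mem (k + 1) y).2 (pow_succ_le_prodFrom hδ hA ((mem _ _).1 hxk) h3))
        have : s (W * m) ⊂ s (W * (m + 1)) :=
          (ssubset_iff_of_subset (mono hle)).2 ⟨y, hyk, hy⟩
        have := card_lt_card this
        omega
  rcases key (Fintype.card ι) with h | h
  · exact (mem _ _).1 (h ▸ mem_univ i)
  · have := (s (W * Fintype.card ι)).card_le_univ
    omega

variable {A B : ℕ → Matrix ι ι ℝ}

/-- What averaging takes away from the total of the states is put into the surpluses: the columns of
the full block matrix add up to 1. This conservation makes the average obey an exact descent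
recursion. -/
theorem sum_lowerFrom (hB : ∀ t, B t ∈ Matrix.colStochastic ℝ ι) (t k : ℕ) (j : ι) :
    ∑ i, lowerFrom A B t k i j = 1 - ∑ i, prodFrom A t k i j := by
  induction k with
  | zero => simp [lowerFrom, prodFrom, Matrix.one_apply]
  | succ k ih =>
    simp only [lowerFrom, prodFrom, Matrix.add_apply, sum_add_distrib, Matrix.sub_mul,
      Matrix.one_mul, Matrix.sub_apply, sum_sub_distrib]
    have : ∑ i, (B (t + k) * lowerFrom A B t k) i j = ∑ i, lowerFrom A B t k i j := by
      simp only [Matrix.mul_apply]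
      rw [sum_comm]
      simp [← sum_mul, Matrix.sum_col_of_mem_colStochastic (hB _)]
    rw [this, ih]; ring

/-- Each 1 - A kills constants, which the earlier factors preserve: states in agreement create no
surplus. Hence the states disturb the surpluses only through their spread. -/
theorem lowerFrom_mulVec_one (hA : ∀ t, A t ∈ Matrix.rowStochastic ℝ ι) (t k : ℕ) :
    (lowerFrom A B t k).mulVec 1 = 0 := by
  induction k with
  | zero => simp [lowerFrom]
  | succ k ih =>
    rw [lowerFrom, Matrix.add_mulVec, ← Matrix.mulVec_mulVec, ← Matrix.mulVec_mulVec, ih,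
      Matrix.one_vecMul_of_mem_rowStochastic (prodFrom_mem hA t k), Matrix.sub_mulVec,
      Matrix.one_vecMul_of_mem_rowStochastic (hA _)]
    simp

theorem sum_abs_mulVec_le {B : Matrix ι ι ℝ} (hB : B ∈ Matrix.colStochastic ℝ ι) (v : ι → ℝ) :
    ∑ i, |B.mulVec v i| ≤ ∑ i, |v i| := by
  calc ∑ i, |B.mulVec v i| ≤ ∑ i, ∑ j, B i j * |v j| := by
        refine sum_le_sum fun i _ => (abs_sum_le_sum_abs _ _).trans (sum_le_sum fun j _ => ?_)
        rw [abs_mul, abs_of_nonneg (Matrix.nonneg_of_mem_colStochastic hB)]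
    _ = ∑ j, |v j| := by
        rw [sum_comm]
        simp [← sum_mul, Matrix.sum_col_of_mem_colStochastic hB]

/-- Each step adds the difference of two consecutive stochastic products, whose entries lie in [-1,
1], and applying B does not increase ℓ¹ norms. -/
theorem sum_abs_lowerFrom_le (hA : ∀ t, A t ∈ Matrix.rowStochastic ℝ ι)
    (hB : ∀ t, B t ∈ Matrix.colStochastic ℝ ι) (t k : ℕ) (j : ι) :
    ∑ i, |lowerFrom A B t k i j| ≤ Fintype.card ι * k := by
  induction k with
  | zero => simp [lowerFrom]
  | succ k ih =>
    have h1 : ∑ i, |((1 - A (t + k)) * prodFrom A t k) i j| ≤ Fintype.card ι := by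
      have : ∀ i ∈ univ, |((1 - A (t + k)) * prodFrom A t k) i j| ≤ 1 := by
        intro i _
        have hP := prodFrom_mem hA t k
        have hP' := prodFrom_mem hA t (k + 1)
        rw [Matrix.sub_mul, Matrix.one_mul, Matrix.sub_apply]
        change |prodFrom A t k i j - prodFrom A t (k + 1) i j| ≤ 1
        have a1 := Matrix.nonneg_of_mem_rowStochastic hP (i := i) (j := j)
        have a2 := Matrix.le_one_of_mem_rowStochastic hP (i := i) (j := j)
        have a3 := Matrix.nonneg_of_mem_rowStochastic hP' (i := i) (j := j)
        have a4 := Matrix.le_one_of_mem_rowStochastic hP' (i := i) (j := j)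
        rw [abs_le]; constructor <;> linarith
      simpa using sum_le_sum this
    have h2 : ∑ i, |(B (t + k) * lowerFrom A B t k) i j| ≤ Fintype.card ι * k :=
      (sum_abs_mulVec_le (hB (t + k)) fun i => lowerFrom A B t k i j).trans ih
    calc ∑ i, |lowerFrom A B t (k + 1) i j|
        ≤ ∑ i, (|((1 - A (t + k)) * prodFrom A t k) i j| +
            |(B (t + k) * lowerFrom A B t k) i j|) := sum_le_sum fun i _ => abs_add_le _ _
      _ ≤ Fintype.card ι * ((k + 1 : ℕ) : ℝ) := by
        rw [sum_add_distrib]; push_cast; linarith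

/-! ### Contraction of spreads and of vectors of sum zero -/

/-- The largest difference of two entries. -/
def spread (v : ι → ℝ) : ℝ := ‖fun p : ι × ι => v p.1 - v p.2‖

theorem sub_le_spread (v : ι → ℝ) (i j : ι) : |v i - v j| ≤ spread v :=
  norm_le_pi_norm (fun p : ι × ι => v p.1 - v p.2) (i, j)

theorem spread_nonneg (v : ι → ℝ) : 0 ≤ spread v := norm_nonneg _

theorem spread_le {v : ι → ℝ} {c : ℝ} (hc : 0 ≤ c) (h : ∀ i j, v i - v j ≤ c) : spread v ≤ c :=
  (pi_norm_le_iff_of_nonneg hc).2 fun p => by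
    rw [Real.norm_eq_abs, abs_le]
    have h1 := h p.1 p.2
    have h2 := h p.2 p.1
    constructor <;> linarith

theorem spread_add_le (v w : ι → ℝ) : spread (v + w) ≤ spread v + spread w := by
  refine le_trans (le_of_eq ?_) (norm_add_le (fun p : ι × ι => v p.1 - v p.2) _)
  unfold spread
  congr 1; funext p; simp only [Pi.add_apply]; ring

theorem spread_le_two_mul_norm (v : ι → ℝ) : spread v ≤ 2 * ‖v‖ :=
  spread_le (by positivity) fun i j => by
    have h1 := abs_le.1 (norm_le_pi_norm v i)
    have h2 := abs_le.1 (norm_le_pi_norm v j)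
    linarith

theorem mulVec_le_of_le {A : Matrix ι ι ℝ} (hA : A ∈ Matrix.rowStochastic ℝ ι) {κ : ℝ}
    {v : ι → ℝ} {m : ℝ} (h : ∀ j, v j ≤ m) (i j₀ : ι) (hκ : κ ≤ A i j₀) :
    A.mulVec v i ≤ κ * v j₀ + (1 - κ) * m := by
  have h1 : A.mulVec v i = ∑ j, A i j * (v j - m) + m := by
    simp only [mul_sub, sum_sub_distrib, ← sum_mul, Matrix.sum_row_of_mem_rowStochastic hA]
    simp [Matrix.mulVec, dotProduct]
  have h2 : ∑ j, A i j * (v j - m) ≤ A i j₀ * (v j₀ - m) := by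
    rw [← add_sum_erase univ _ (mem_univ j₀)]
    have : ∑ j ∈ univ.erase j₀, A i j * (v j - m) ≤ 0 :=
      sum_nonpos fun j _ => mul_nonpos_of_nonneg_of_nonpos
        (Matrix.nonneg_of_mem_rowStochastic hA) (by linarith [h j])
    linarith
  have h3 : A i j₀ * (v j₀ - m) ≤ κ * (v j₀ - m) :=
    mul_le_mul_of_nonpos_right hκ (by linarith [h j₀])
  linarith

/-- Doeblin's argument: every row gives weight at least κ to the position of the maximum, so no
average exceeds the maximum and every average is at least κ · max + (1 - κ) · min. -/
theorem spread_mulVec_le {A : Matrix ι ι ℝ} (hA : A ∈ Matrix.rowStochastic ℝ ι) {κ : ℝ}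
    (hκ1 : κ ≤ 1) (hκ : ∀ i j, κ ≤ A i j) (v : ι → ℝ) :
    spread (A.mulVec v) ≤ (1 - κ) * spread v := by
  rcases isEmpty_or_nonempty ι with hι | hι
  · have : spread v = 0 := le_antisymm (spread_le le_rfl fun i => isEmptyElim i) (spread_nonneg v)
    rw [this, mul_zero]
    exact spread_le le_rfl fun i => isEmptyElim i
  obtain ⟨a, ha⟩ := Finite.exists_max v
  obtain ⟨b, hb⟩ := Finite.exists_min v
  refine spread_le (mul_nonneg (by linarith) (spread_nonneg v)) fun i k => ?_
  have h1 := mulVec_le_of_le hA (κ := κ) ha i a (hκ _ _)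
  have h2 := mulVec_le_of_le hA (κ := κ) (v := -v) (m := -v b) (fun j => neg_le_neg (hb j)) k a
    (hκ _ _)
  rw [Matrix.mulVec_neg] at h2
  simp only [Pi.neg_apply] at h2
  have h3 := (abs_le.1 (sub_le_spread v a b)).2
  have h4 : (1 - κ) * (v a - v b) ≤ (1 - κ) * spread v :=
    mul_le_mul_of_nonneg_left h3 (by linarith)
  linarith

/-- On vectors of sum zero, subtracting κ from all entries of B changes nothing, and what remains is
nonnegative with smaller column sums. -/
theorem sum_abs_mulVec_le_of_sum_eq_zero {B : Matrix ι ι ℝ} (hB : B ∈ Matrix.colStochastic ℝ ι)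
    {κ : ℝ} (hκ0 : 0 ≤ κ) (hκ : ∀ i j, κ ≤ B i j) {v : ι → ℝ} (hv : ∑ i, v i = 0) :
    ∑ i, |B.mulVec v i| ≤ (1 - κ) * ∑ i, |v i| := by
  rcases isEmpty_or_nonempty ι with hι | hι
  · simp
  have hrw : ∀ i, B.mulVec v i = ∑ j, (B i j - κ) * v j := fun i => by
    simp only [sub_mul, sum_sub_distrib, ← mul_sum, hv, mul_zero, sub_zero]
    rfl
  calc ∑ i, |B.mulVec v i| ≤ ∑ i, ∑ j, (B i j - κ) * |v j| := by
        refine sum_le_sum fun i _ => ?_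
        rw [hrw]
        refine (abs_sum_le_sum_abs _ _).trans (sum_le_sum fun j _ => ?_)
        rw [abs_mul, abs_of_nonneg (sub_nonneg.2 (hκ i j))]
    _ = ∑ j, (1 - Fintype.card ι * κ) * |v j| := by
        rw [sum_comm]
        simp [← sum_mul, sum_sub_distrib, Matrix.sum_col_of_mem_colStochastic hB]
    _ ≤ (1 - κ) * ∑ i, |v i| := by
        rw [← mul_sum]
        refine mul_le_mul_of_nonneg_right ?_ (sum_nonneg fun _ _ => abs_nonneg _)
        have : (1 : ℝ) ≤ Fintype.card ι := by exact_mod_cast Fintype.card_pos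
        nlinarith

theorem norm_mulVec_le {A : Matrix ι ι ℝ} (hA : A ∈ Matrix.rowStochastic ℝ ι) (v : ι → ℝ) :
    ‖A.mulVec v‖ ≤ ‖v‖ := by
  refine (pi_norm_le_iff_of_nonneg (norm_nonneg _)).2 fun i => ?_
  calc ‖A.mulVec v i‖ ≤ ∑ j, A i j * ‖v‖ := by
        refine (norm_sum_le _ _).trans (sum_le_sum fun j _ => ?_)
        rw [norm_mul, Real.norm_of_nonneg (Matrix.nonneg_of_mem_rowStochastic hA)]
        exact mul_le_mul_of_nonneg_left (norm_le_pi_norm v j)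
          (Matrix.nonneg_of_mem_rowStochastic hA)
    _ = ‖v‖ := by rw [← sum_mul, Matrix.sum_row_of_mem_rowStochastic hA, one_mul]

end Products

/-! ### Surplus-based averaging -/

section Surplus

set_option linter.unusedSectionVars false

variable {ι : Type*} [Fintype ι] [DecidableEq ι]

/-- Spread accumulated over the next `Q` steps: a Lyapunov function of the averaging iteration. -/
def accSpread (A : ℕ → Matrix ι ι ℝ) (Q q : ℕ) (v : ι → ℝ) : ℝ :=
  ∑ j ∈ range Q, spread ((prodFrom A q j).mulVec v)

/-- `ℓ¹` norm accumulated over the next `Q` steps. -/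
def accAbs (B : ℕ → Matrix ι ι ℝ) (Q q : ℕ) (v : ι → ℝ) : ℝ :=
  ∑ j ∈ range Q, ∑ i, |(prodFrom B q j).mulVec v i|

/-- Turns a contraction over Q steps into a one-step contraction of window sums: the shift exchanges
f 0 for f Q, a loss of at least κ f 0, and f 0 is at least the mean of the window. -/
theorem sum_range_shift_le {f : ℕ → ℝ} {Q : ℕ} {κ : ℝ} (hQ : 0 < Q) (hκ0 : 0 ≤ κ)
    (hf : ∀ j, f j ≤ f 0) (hlast : f Q ≤ (1 - κ) * f 0) :
    ∑ j ∈ range Q, f (j + 1) ≤ (1 - κ / Q) * ∑ j ∈ range Q, f j := by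
  have h1 : ∑ j ∈ range Q, f (j + 1) + f 0 = ∑ j ∈ range Q, f j + f Q := by
    rw [← sum_range_succ', sum_range_succ]
  have h2 : ∑ j ∈ range Q, f j ≤ Q * f 0 := by
    simpa using sum_le_sum fun j (_ : j ∈ range Q) => hf j
  have hQ' : (0 : ℝ) < Q := by exact_mod_cast hQ
  have h3 : κ / Q * ∑ j ∈ range Q, f j ≤ κ * f 0 := by
    calc κ / Q * ∑ j ∈ range Q, f j ≤ κ / Q * (Q * f 0) :=
          mul_le_mul_of_nonneg_left h2 (by positivity)
      _ = κ * f 0 := by field_simp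
  linarith

section Acc

variable {A B : ℕ → Matrix ι ι ℝ} {κ : ℝ} {Q : ℕ}

theorem spread_prodFrom_le (hA : ∀ t, A t ∈ Matrix.rowStochastic ℝ ι) (q j : ℕ) (v : ι → ℝ) :
    spread ((prodFrom A q j).mulVec v) ≤ spread v := by
  have hP := prodFrom_mem hA q j
  simpa using spread_mulVec_le hP (κ := 0) zero_le_one
    (fun _ _ => Matrix.nonneg_of_mem_rowStochastic hP) v

theorem accSpread_step (hQ : 0 < Q) (hA : ∀ t, A t ∈ Matrix.rowStochastic ℝ ι) (hκ0 : 0 ≤ κ)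
    (hκ1 : κ ≤ 1) (hκ : ∀ q i j, κ ≤ prodFrom A q Q i j) (q : ℕ) (v : ι → ℝ) :
    accSpread A Q (q + 1) ((A q).mulVec v) ≤ (1 - κ / Q) * accSpread A Q q v := by
  have := sum_range_shift_le (f := fun j => spread ((prodFrom A q j).mulVec v)) hQ hκ0
    (fun j => by simpa [prodFrom] using spread_prodFrom_le hA q j v)
    (by simpa [prodFrom] using spread_mulVec_le (prodFrom_mem hA q Q) hκ1 (hκ q) v)
  simpa [accSpread, prodFrom_succ_left] using this

theorem accAbs_step (hQ : 0 < Q) (hB : ∀ t, B t ∈ Matrix.colStochastic ℝ ι) (hκ0 : 0 ≤ κ)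
    (hκ : ∀ q i j, κ ≤ prodFrom B q Q i j) (q : ℕ) {v : ι → ℝ} (hv : ∑ i, v i = 0) :
    accAbs B Q (q + 1) ((B q).mulVec v) ≤ (1 - κ / Q) * accAbs B Q q v := by
  have := sum_range_shift_le (f := fun j => ∑ i, |(prodFrom B q j).mulVec v i|) hQ hκ0
    (fun j => by simpa [prodFrom] using sum_abs_mulVec_le (prodFrom_mem hB q j) v)
    (by simpa [prodFrom] using
      sum_abs_mulVec_le_of_sum_eq_zero (prodFrom_mem hB q Q) hκ0 (hκ q) hv)
  simpa [accAbs, prodFrom_succ_left] using this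

theorem accSpread_add_le (q : ℕ) (v w : ι → ℝ) :
    accSpread A Q q (v + w) ≤ accSpread A Q q v + accSpread A Q q w := by
  rw [accSpread, accSpread, accSpread, ← sum_add_distrib]
  refine sum_le_sum fun j _ => ?_
  rw [Matrix.mulVec_add]
  exact spread_add_le _ _

theorem accAbs_add_le (q : ℕ) (v w : ι → ℝ) :
    accAbs B Q q (v + w) ≤ accAbs B Q q v + accAbs B Q q w := by
  rw [accAbs, accAbs, accAbs, ← sum_add_distrib]
  refine sum_le_sum fun j _ => ?_
  rw [← sum_add_distrib]
  refine sum_le_sum fun i _ => ?_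
  rw [Matrix.mulVec_add]
  exact abs_add_le _ _

theorem accSpread_le (hA : ∀ t, A t ∈ Matrix.rowStochastic ℝ ι) (q : ℕ) (v : ι → ℝ) :
    accSpread A Q q v ≤ Q * spread v := by
  simpa [accSpread] using sum_le_sum fun j (_ : j ∈ range Q) => spread_prodFrom_le hA q j v

theorem accAbs_le (hB : ∀ t, B t ∈ Matrix.colStochastic ℝ ι) (q : ℕ) (v : ι → ℝ) :
    accAbs B Q q v ≤ Q * ∑ i, |v i| := by
  simpa [accAbs] using
    sum_le_sum fun j (_ : j ∈ range Q) => sum_abs_mulVec_le (prodFrom_mem hB q j) v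

theorem spread_le_accSpread (hQ : 0 < Q) (q : ℕ) (v : ι → ℝ) :
    spread v ≤ accSpread A Q q v := by
  have := single_le_sum (f := fun j => spread ((prodFrom A q j).mulVec v))
    (fun j _ => spread_nonneg _) (mem_range.2 hQ)
  simpa [prodFrom, accSpread, accAbs] using this

theorem sum_abs_le_accAbs (hQ : 0 < Q) (q : ℕ) (v : ι → ℝ) :
    ∑ i, |v i| ≤ accAbs B Q q v := by
  have := single_le_sum (f := fun j => ∑ i, |(prodFrom B q j).mulVec v i|)
    (fun j _ => sum_nonneg fun _ _ => abs_nonneg _) (mem_range.2 hQ)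
  simpa [prodFrom, accSpread, accAbs] using this

end Acc

/-- Evolution of a uniform unit mass under column-stochastic matrices. -/
def massFrom (B : ℕ → Matrix ι ι ℝ) : ℕ → ι → ℝ
  | 0 => fun _ => 1 / (Fintype.card ι : ℝ)
  | q + 1 => (B q).mulVec (massFrom B q)

theorem massFrom_add (B : ℕ → Matrix ι ι ℝ) (q k : ℕ) :
    massFrom B (q + k) = (prodFrom B q k).mulVec (massFrom B q) := by
  induction k with
  | zero => simp [prodFrom]
  | succ k ih => rw [← add_assoc, massFrom, ih, Matrix.mulVec_mulVec, prodFrom]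

theorem massFrom_nonneg {B : ℕ → Matrix ι ι ℝ} (hB : ∀ t, B t ∈ Matrix.colStochastic ℝ ι)
    (q : ℕ) (i : ι) : 0 ≤ massFrom B q i := by
  induction q generalizing i with
  | zero => simp only [massFrom]; positivity
  | succ q ih =>
    exact sum_nonneg fun j _ => mul_nonneg (Matrix.nonneg_of_mem_colStochastic (hB q)) (ih j)

theorem sum_massFrom [Nonempty ι] {B : ℕ → Matrix ι ι ℝ}
    (hB : ∀ t, B t ∈ Matrix.colStochastic ℝ ι) (q : ℕ) : ∑ i, massFrom B q i = 1 := by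
  induction q with
  | zero => simp [massFrom]
  | succ q ih => rw [massFrom, Matrix.sum_mulVec_of_mem_colStochastic (hB q), ih]

/-- The block matrices `[A 0; C B]` of the joint update of states and surpluses over one period;
products of `Q` of their diagonal blocks are bounded below by `κ`. -/
structure SurplusMatrices (A B C : ℕ → Matrix ι ι ℝ) (κ K : ℝ) (Q : ℕ) : Prop where
  rowA : ∀ q, A q ∈ Matrix.rowStochastic ℝ ι
  colB : ∀ q, B q ∈ Matrix.colStochastic ℝ ι
  prodA : ∀ q i j, κ ≤ prodFrom A q Q i j
  prodB : ∀ q i j, κ ≤ prodFrom B q Q i j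
  diagB : ∀ q k, k ≤ Q → ∀ i, κ ≤ prodFrom B q k i i
  oneC : ∀ q, (C q).mulVec 1 = 0
  absC : ∀ q j, ∑ i, |C q i j| ≤ K

namespace SurplusMatrices

variable {A B C : ℕ → Matrix ι ι ℝ} {κ K : ℝ} {Q : ℕ}

/-- Up to time Q, the diagonal of the product retains at least the fraction κ of the initial mass
1/n at i; later, the last Q factors send at least κ of the total mass 1 to every vertex. -/
theorem le_card_mul_massFrom [Nonempty ι] (h : SurplusMatrices A B C κ K Q) (hκ : 0 ≤ κ)
    (q : ℕ) (i : ι) : κ ≤ Fintype.card ι * massFrom B q i := by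
  have hn : (1 : ℝ) ≤ Fintype.card ι := by exact_mod_cast Fintype.card_pos
  rcases le_total q Q with hq | hq
  · have h1 := massFrom_add B 0 q
    rw [zero_add] at h1
    have h2 : prodFrom B 0 q i i * massFrom B 0 i ≤ massFrom B q i := by
      rw [h1]
      exact single_le_sum (f := fun j => prodFrom B 0 q i j * massFrom B 0 j)
        (fun j _ => mul_nonneg
          (Matrix.nonneg_of_mem_colStochastic (prodFrom_mem h.colB 0 q))
          (massFrom_nonneg h.colB 0 j)) (mem_univ i)
    have h3 := h.diagB 0 q hq i
    have h4 : Fintype.card ι * (prodFrom B 0 q i i * massFrom B 0 i) = prodFrom B 0 q i i := by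
      simp only [massFrom]; field_simp
    nlinarith
  · obtain ⟨k, rfl⟩ := Nat.exists_eq_add_of_le' hq
    have h2 : κ ≤ massFrom B (k + Q) i := by
      rw [massFrom_add]
      calc κ = ∑ j, κ * massFrom B k j := by rw [← mul_sum, sum_massFrom h.colB, mul_one]
        _ ≤ _ := sum_le_sum fun j _ =>
          mul_le_mul_of_nonneg_right (h.prodB k i j) (massFrom_nonneg h.colB k j)
    nlinarith [massFrom_nonneg h.colB (k + Q) i]

theorem sum_abs_mulVec_C_le [Nonempty ι] (h : SurplusMatrices A B C κ K Q) (q : ℕ)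
    (v : ι → ℝ) : ∑ i, |(C q).mulVec v i| ≤ Fintype.card ι * K * spread v := by
  obtain ⟨i₀⟩ := ‹Nonempty ι›
  have hv : (C q).mulVec v = (C q).mulVec (v - v i₀ • (1 : ι → ℝ)) := by
    rw [Matrix.mulVec_sub, Matrix.mulVec_smul, h.oneC, smul_zero, sub_zero]
  calc ∑ i, |(C q).mulVec v i| ≤ ∑ i, ∑ j, |C q i j| * spread v := by
        refine sum_le_sum fun i _ => ?_
        rw [hv]
        refine (abs_sum_le_sum_abs _ _).trans (sum_le_sum fun j _ => ?_)
        rw [abs_mul]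
        refine mul_le_mul_of_nonneg_left ?_ (abs_nonneg _)
        simpa using sub_le_spread v j i₀
    _ = ∑ j, (∑ i, |C q i j|) * spread v := by rw [sum_comm]; simp [sum_mul]
    _ ≤ ∑ _j : ι, K * spread v := sum_le_sum fun j _ =>
        mul_le_mul_of_nonneg_right (h.absC q j) (spread_nonneg v)
    _ = Fintype.card ι * K * spread v := by simp [mul_assoc]

variable [Nonempty ι] (h : SurplusMatrices A B C κ K Q)
include h

/-- With ψ = n φ_i and m the mean of y, the mass part of the surplus feeds back -η ψ m. Replacing m
by (A y)_i costs only the spread and leaves (A y)_i with the factor 1 - η ψ, where κ ≤ ψ ≤ n; `hηn`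
keeps this factor nonnegative. -/
theorem norm_step (hκ : 0 ≤ κ) {η : ℝ} (hη : 0 ≤ η) (hηn : η * Fintype.card ι ≤ 1) {q : ℕ}
    {y s e u : ι → ℝ} (hs : ∀ i, s i = e i - (∑ k, y k) * massFrom B q i) :
    ‖(A q).mulVec y + η • s - u‖ ≤
      (1 - η * κ) * ‖y‖ + η * Fintype.card ι * spread y + η * ∑ i, |e i| + ‖u‖ := by
  have hn : (0 : ℝ) < Fintype.card ι := by exact_mod_cast Fintype.card_pos
  refine (pi_norm_le_iff_of_nonempty _).2 fun i => ?_
  set ψ := Fintype.card ι * massFrom B q i with hψ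
  set m := (∑ k, y k) / Fintype.card ι with hm
  set b := (A q).mulVec y i with hb
  have hψκ : κ ≤ ψ := h.le_card_mul_massFrom hκ q i
  have hψn : ψ ≤ Fintype.card ι := by
    have : massFrom B q i ≤ 1 := by
      rw [← sum_massFrom h.colB q]
      exact single_le_sum (fun j _ => massFrom_nonneg h.colB q j) (mem_univ i)
    nlinarith
  have hbm : |b - m| ≤ spread y := by
    have h1 : b - m = ∑ j, A q i j * ∑ k, (y j - y k) / Fintype.card ι := by
      have : ∀ j, ∑ k, (y j - y k) / (Fintype.card ι : ℝ) = y j - m := fun j => by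
        rw [← sum_div, sum_sub_distrib, sub_div, hm]
        simp [hn.ne']
      simp only [this, mul_sub, sum_sub_distrib, ← sum_mul,
        Matrix.sum_row_of_mem_rowStochastic (h.rowA q), one_mul]
      rfl
    rw [h1]
    calc _ ≤ ∑ j, A q i j * spread y := by
          refine (abs_sum_le_sum_abs _ _).trans (sum_le_sum fun j _ => ?_)
          rw [abs_mul, abs_of_nonneg (Matrix.nonneg_of_mem_rowStochastic (h.rowA q))]
          refine mul_le_mul_of_nonneg_left ?_ (Matrix.nonneg_of_mem_rowStochastic (h.rowA q))
          calc _ ≤ ∑ _k : ι, spread y / Fintype.card ι := by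
                refine (abs_sum_le_sum_abs _ _).trans (sum_le_sum fun k _ => ?_)
                rw [abs_div, abs_of_pos hn]
                exact div_le_div_of_nonneg_right (sub_le_spread y j k) hn.le
            _ = spread y := by simp; field_simp
      _ = spread y := by
          rw [← sum_mul, Matrix.sum_row_of_mem_rowStochastic (h.rowA q), one_mul]
  have hba : |b| ≤ ‖y‖ := (norm_le_pi_norm _ i).trans (norm_mulVec_le (h.rowA q) y)
  have hdec : ((A q).mulVec y + η • s - u) i =
      (1 - η * ψ) * b + η * ψ * (b - m) + η * e i - u i := by
    simp only [Pi.add_apply, Pi.sub_apply, Pi.smul_apply, smul_eq_mul, hs, hψ, hm, ← hb]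
    field_simp
    ring
  have hψ0 : 0 ≤ ψ := hκ.trans hψκ
  have hηψ : η * ψ ≤ 1 := (mul_le_mul_of_nonneg_left hψn hη).trans hηn
  have e1 : |(1 - η * ψ) * b| ≤ (1 - η * κ) * ‖y‖ := by
    rw [abs_mul, abs_of_nonneg (by linarith)]
    exact mul_le_mul (by nlinarith) hba (abs_nonneg _) (by nlinarith)
  have e2 : |η * ψ * (b - m)| ≤ η * Fintype.card ι * spread y := by
    rw [abs_mul, abs_of_nonneg (by positivity)]
    exact mul_le_mul (mul_le_mul_of_nonneg_left hψn hη) hbm (abs_nonneg _) (by positivity)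
  have e3 : |η * e i| ≤ η * ∑ i, |e i| := by
    rw [abs_mul, abs_of_nonneg hη]
    exact mul_le_mul_of_nonneg_left
      (single_le_sum (f := fun i => |e i|) (fun _ _ => abs_nonneg _) (mem_univ i)) hη
  have e4 : |u i| ≤ ‖u‖ := norm_le_pi_norm u i
  rw [hdec, Real.norm_eq_abs]
  have t1 := abs_sub ((1 - η * ψ) * b + η * ψ * (b - m) + η * e i) (u i)
  have t2 := abs_add_le ((1 - η * ψ) * b + η * ψ * (b - m)) (η * e i)
  have t3 := abs_add_le ((1 - η * ψ) * b) (η * ψ * (b - m))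
  linarith

omit h in
theorem sum_abs_surplus_le {y s e φ : ι → ℝ} (hφ0 : ∀ i, 0 ≤ φ i) (hφ1 : ∑ i, φ i = 1)
    (hs : ∀ i, s i = e i - (∑ k, y k) * φ i) :
    ∑ i, |s i| ≤ ∑ i, |e i| + Fintype.card ι * ‖y‖ := by
  have h1 : |∑ k, y k| ≤ Fintype.card ι * ‖y‖ := by
    refine (abs_sum_le_sum_abs _ _).trans ?_
    simpa using sum_le_sum fun i (_ : i ∈ univ) => norm_le_pi_norm y i
  calc ∑ i, |s i| ≤ ∑ i, (|e i| + |∑ k, y k| * φ i) := by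
        refine sum_le_sum fun i _ => ?_
        rw [hs i]
        refine (abs_sub _ _).trans ?_
        rw [abs_mul, abs_of_nonneg (hφ0 i)]
    _ = ∑ i, |e i| + |∑ k, y k| := by rw [sum_add_distrib, ← mul_sum, hφ1, mul_one]
    _ ≤ _ := by linarith

theorem accSpread_surplus_step (hQ : 0 < Q) (hκ : 0 ≤ κ) (hκ1 : κ ≤ 1) {η : ℝ} (hη : 0 ≤ η)
    {q : ℕ} {y s e u : ι → ℝ} (hs : ∀ i, s i = e i - (∑ k, y k) * massFrom B q i) :
    accSpread A Q (q + 1) ((A q).mulVec y + η • s - u) ≤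
      (1 - κ / Q) * accSpread A Q q y +
        2 * η * Q * (∑ i, |e i| + Fintype.card ι * ‖y‖) + 2 * Q * ‖u‖ := by
  have h1 := accSpread_step hQ h.rowA hκ hκ1 h.prodA q y
  have h2 := accSpread_add_le (A := A) (Q := Q) (q + 1) ((A q).mulVec y) (η • s + -u)
  have h3 := accSpread_le (Q := Q) h.rowA (q + 1) (η • s + -u)
  have h4 : spread (η • s + -u) ≤ 2 * (η * (∑ i, |e i| + Fintype.card ι * ‖y‖) + ‖u‖) := by
    refine (spread_le_two_mul_norm _).trans (mul_le_mul_of_nonneg_left ?_ zero_le_two)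
    refine (norm_add_le _ _).trans (add_le_add ?_ (norm_neg u).le)
    rw [norm_smul, Real.norm_of_nonneg hη]
    refine mul_le_mul_of_nonneg_left ?_ hη
    refine le_trans ((pi_norm_le_iff_of_nonempty _).2 fun i => ?_)
      (sum_abs_surplus_le (massFrom_nonneg h.colB q) (sum_massFrom h.colB q) hs)
    exact single_le_sum (f := fun i => |s i|) (fun _ _ => abs_nonneg _) (mem_univ i)
  have h5 : (Q : ℝ) * spread (η • s + -u) ≤
      Q * (2 * (η * (∑ i, |e i| + Fintype.card ι * ‖y‖) + ‖u‖)) :=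
    mul_le_mul_of_nonneg_left h4 (Nat.cast_nonneg _)
  rw [← add_assoc, ← sub_eq_add_neg] at h2
  linarith

/-- B carries φ_q to φ_{q+1}, so the mass part of the surplus reproduces itself. Besides B e there
remain only the recentred inflow C y, of the size of the spread, and feedback terms of order η. -/
theorem accAbs_surplus_step (hQ : 0 < Q) (hκ : 0 ≤ κ) {η : ℝ} (hη : 0 ≤ η)
    {q : ℕ} {y s s' e e' : ι → ℝ} (hs : ∀ i, s i = e i - (∑ k, y k) * massFrom B q i)
    (he : ∑ i, e i = 0) (hss : s' = (C q).mulVec y + (B q).mulVec s - η • s)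
    (he' : ∀ i, e' i = s' i - (∑ k, s' k) * massFrom B (q + 1) i) :
    accAbs B Q (q + 1) e' ≤
      (1 - κ / Q) * accAbs B Q q e + Q * (2 * (Fintype.card ι * K * spread y) +
        η * ∑ i, |e i| + 2 * η * (Fintype.card ι * ‖y‖)) := by
  set φ := massFrom B q with hφ
  set φ' := massFrom B (q + 1) with hφ'
  set T := ∑ k, y k with hT
  have hφ1 : ∑ i, φ i = 1 := sum_massFrom h.colB q
  have hφ1' : ∑ i, φ' i = 1 := sum_massFrom h.colB (q + 1)
  have hsum : ∑ i, s i = -T := by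
    simp only [hs, sum_sub_distrib, he, ← mul_sum, hφ1]; ring
  have hBs : (B q).mulVec s = (B q).mulVec e - T • φ' := by
    have : s = e - T • φ := by funext i; simp [hs i]
    rw [this, Matrix.mulVec_sub, Matrix.mulVec_smul]; rfl
  set c := (C q).mulVec y with hc
  have hsum' : ∑ k, s' k = ∑ k, c k - T + η * T := by
    have : ∑ k, (B q).mulVec s k = -T := by
      rw [Matrix.sum_mulVec_of_mem_colStochastic (h.colB q), hsum]
    simp only [hss, Pi.sub_apply, Pi.add_apply, Pi.smul_apply, smul_eq_mul, sum_sub_distrib,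
      sum_add_distrib, this, ← mul_sum, hsum]
    ring
  set w : ι → ℝ := fun i => c i - (∑ k, c k) * φ' i - η * e i + η * T * (φ i - φ' i) with hw
  have hdec : e' = (B q).mulVec e + w := by
    funext i
    rw [he' i, hsum', hss, hBs]
    simp only [hw, Pi.sub_apply, Pi.add_apply, Pi.smul_apply, smul_eq_mul, hs i]
    ring
  have hT' : |T| ≤ Fintype.card ι * ‖y‖ := by
    refine (abs_sum_le_sum_abs _ _).trans ?_
    simpa using sum_le_sum fun i (_ : i ∈ univ) => norm_le_pi_norm y i
  have hcs : ∑ i, |c i| ≤ Fintype.card ι * K * spread y := h.sum_abs_mulVec_C_le q y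
  have hwn : ∑ i, |w i| ≤ 2 * (Fintype.card ι * K * spread y) + η * ∑ i, |e i| +
      2 * η * (Fintype.card ι * ‖y‖) := by
    calc ∑ i, |w i| ≤ ∑ i, (|c i| + |∑ k, c k| * φ' i + η * |e i| + η * |T| * (φ i + φ' i)) := by
          refine sum_le_sum fun i _ => ?_
          have p1 := massFrom_nonneg h.colB q i
          have p2 := massFrom_nonneg h.colB (q + 1) i
          have t1 := abs_add_le (c i - (∑ k, c k) * φ' i - η * e i) (η * T * (φ i - φ' i))
          have t2 := abs_sub (c i - (∑ k, c k) * φ' i) (η * e i)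
          have t3 := abs_sub (c i) ((∑ k, c k) * φ' i)
          have t4 := abs_sub (φ i) (φ' i)
          rw [abs_mul (∑ k, c k), abs_of_nonneg p2] at t3
          rw [abs_mul η, abs_of_nonneg hη] at t2
          rw [abs_mul (η * T), abs_mul η, abs_of_nonneg hη] at t1
          rw [abs_of_nonneg p1, abs_of_nonneg p2] at t4
          have t5 : η * |T| * |φ i - φ' i| ≤ η * |T| * (φ i + φ' i) :=
            mul_le_mul_of_nonneg_left t4 (by positivity)
          change |c i - (∑ k, c k) * φ' i - η * e i + η * T * (φ i - φ' i)| ≤ _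
          linarith
      _ = ∑ i, |c i| + |∑ k, c k| + η * ∑ i, |e i| + η * |T| * (1 + 1) := by
          simp only [sum_add_distrib, ← mul_sum, hφ1, hφ1', mul_one]
      _ ≤ _ := by
          have := abs_sum_le_sum_abs c univ
          have t6 : η * |T| ≤ η * (Fintype.card ι * ‖y‖) := mul_le_mul_of_nonneg_left hT' hη
          linarith
  rw [hdec]
  have h1 := accAbs_step hQ h.colB hκ h.prodB q he
  have h2 := accAbs_add_le (B := B) (Q := Q) (q + 1) ((B q).mulVec e) w
  have h3 := accAbs_le (Q := Q) h.colB (q + 1) w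
  have h4 := mul_le_mul_of_nonneg_left hwn (Nat.cast_nonneg (α := ℝ) Q)
  linarith

end SurplusMatrices

end Surplus

/-! ### Small-gain argument and the rate of consensus -/

section ConsensusRate

/-- Three coupled quantities, the first decaying at rate `η κ`, the others at rate `g`, with
couplings of order `η` except for the influence of the second on the third: for small `η` a
weighted sum of them contracts. -/
theorem exists_weights_of_small_gain {n Q κ g K : ℝ} (hn : 1 ≤ n) (hQ : 1 ≤ Q) (hκ : 0 < κ)
    (hκ1 : κ ≤ 1) (hg : 0 < g) (hg1 : g ≤ 1) (hK : 0 ≤ K) :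
    ∃ K₁ K₂ ηbar : ℝ, 0 < K₁ ∧ 0 < K₂ ∧ 0 < ηbar ∧ ∀ η, 0 < η → η < ηbar → η * n ≤ 1 ∧
      ∃ ρ, 0 ≤ ρ ∧ ρ < 1 ∧ ∀ a D E a' D' E' u : ℝ, 0 ≤ a → 0 ≤ D → 0 ≤ E →
        a' ≤ (1 - η * κ) * a + η * n * D + η * E + u →
        D' ≤ (1 - g) * D + 2 * η * Q * (E + n * a) + 2 * Q * u →
        E' ≤ (1 - g) * E + Q * (2 * (K * D) + η * E + 2 * η * (n * a)) →
        a' + K₁ * D' + K₂ * E' ≤ ρ * (a + K₁ * D + K₂ * E) + (1 + 2 * Q * K₁) * u := by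
  -- `K₁` is small enough that the return effect of a on D and E uses at most half of its decay η κ.
  -- `K₂` is small compared with `K₁` because D acts on E without a factor η. Only then is η
  -- restricted, so that the terms η n D and η E use at most a quarter and a half of the decay of D
  -- and E.
  obtain ⟨K₁, hK₁⟩ : ∃ K₁, K₁ = κ / (16 * Q * n) := ⟨_, rfl⟩
  obtain ⟨K₂, hK₂⟩ : ∃ K₂, K₂ = K₁ * g / (8 * Q * (K + 1)) := ⟨_, rfl⟩
  have hK₁0 : 0 < K₁ := by rw [hK₁]; positivity
  have hK₂0 : 0 < K₂ := by rw [hK₂]; positivity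
  have e1 : 16 * Q * n * K₁ = κ := by rw [hK₁]; field_simp
  have e2 : 8 * Q * (K + 1) * K₂ = K₁ * g := by rw [hK₂]; field_simp
  have hQK : 1 ≤ Q * (K + 1) := by nlinarith
  have hK₂₁ : K₂ ≤ K₁ := by nlinarith [mul_le_mul_of_nonneg_right hQK hK₂0.le]
  have hK₁1 : K₁ ≤ 1 := by
    have : 1 ≤ Q * n := by nlinarith
    nlinarith [mul_le_mul_of_nonneg_right this hK₁0.le]
  obtain ⟨M, hM⟩ : ∃ M, M = 2 * (1 + 2 * Q * K₁ + Q * K₂) := ⟨_, rfl⟩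
  have hM0 : 0 < M := by rw [hM]; positivity
  refine ⟨K₁, K₂, min (K₁ * g / (4 * n)) (K₂ * g / M), hK₁0, hK₂0,
    lt_min (by positivity) (by positivity), fun η hη hlt => ?_⟩
  have h1 : η * (4 * n) < K₁ * g :=
    (lt_div_iff₀ (by positivity)).1 (hlt.trans_le (min_le_left _ _))
  have h2 : η * M < K₂ * g := (lt_div_iff₀ hM0).1 (hlt.trans_le (min_le_right _ _))
  have hKg : K₁ * g ≤ 1 := by nlinarith
  have hηn : η * n ≤ 1 := by nlinarith
  have hη1 : η ≤ 1 := by nlinarith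
  refine ⟨hηn, 1 - min (η * κ / 2) (g / 2), ?_, ?_, ?_⟩
  · have := min_le_right (η * κ / 2) (g / 2)
    linarith
  · have : 0 < min (η * κ / 2) (g / 2) := lt_min (by positivity) (by positivity)
    linarith
  intro a D E a' D' E' u ha hD hE h1' h2' h3'
  obtain ⟨μ, hμ⟩ : ∃ μ, μ = min (η * κ / 2) (g / 2) := ⟨_, rfl⟩
  rw [← hμ]
  have m1 : μ ≤ η * κ / 2 := hμ ▸ min_le_left _ _
  have m2 : μ ≤ g / 2 := hμ ▸ min_le_right _ _
  have i2 := mul_le_mul_of_nonneg_left h2' hK₁0.le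
  have i3 := mul_le_mul_of_nonneg_left h3' hK₂0.le
  have ca : 2 * Q * n * (K₁ + K₂) ≤ κ / 2 := by
    have : Q * n * K₂ ≤ Q * n * K₁ := mul_le_mul_of_nonneg_left hK₂₁ (by positivity)
    nlinarith
  have cD : 2 * Q * K * K₂ ≤ K₁ * g / 4 := by nlinarith [mul_pos (by linarith : 0 < Q) hK₂0]
  have ja : η * (2 * Q * n * (K₁ + K₂)) * a ≤ η * (κ / 2) * a :=
    mul_le_mul_of_nonneg_right (mul_le_mul_of_nonneg_left ca hη.le) ha
  have jD : (η * n + 2 * Q * K * K₂) * D ≤ K₁ * g / 2 * D :=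
    mul_le_mul_of_nonneg_right (by linarith) hD
  have jE : (η * (1 + 2 * Q * K₁ + Q * K₂)) * E ≤ K₂ * g / 2 * E :=
    mul_le_mul_of_nonneg_right (by rw [hM] at h2; linarith) hE
  have ka : μ * a ≤ η * κ / 2 * a := mul_le_mul_of_nonneg_right m1 ha
  have kD : μ * (K₁ * D) ≤ g / 2 * (K₁ * D) := mul_le_mul_of_nonneg_right m2 (by positivity)
  have kE : μ * (K₂ * E) ≤ g / 2 * (K₂ * E) := mul_le_mul_of_nonneg_right m2 (by positivity)
  linarith

/-- The decay `1 / √(q + 1)`. -/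
def decay (q : ℕ) : ℝ := 1 / √((q : ℝ) + 1)

theorem decay_pos (q : ℕ) : 0 < decay q := by unfold decay; positivity

theorem decay_antitone {q q' : ℕ} (h : q ≤ q') : decay q' ≤ decay q := by
  unfold decay
  gcongr

theorem decay_le_mul_decay {q q' : ℕ} {c : ℝ} (hc : 0 ≤ c) (h : (q' : ℝ) + 1 ≤ c ^ 2 * (q + 1)) :
    decay q ≤ c * decay q' := by
  unfold decay
  rw [mul_one_div, div_le_div_iff₀ (by positivity) (by positivity), one_mul]
  calc √((q' : ℝ) + 1) ≤ √(c ^ 2 * (q + 1)) := Real.sqrt_le_sqrt h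
    _ = c * √((q : ℝ) + 1) := by rw [Real.sqrt_mul (sq_nonneg c), Real.sqrt_sq hc]

/-- A contraction perturbed by terms `O(1 / √q)` is `O(1 / √q)`. -/
theorem exists_le_mul_decay {ρ : ℝ} (hρ0 : 0 ≤ ρ) (hρ : ρ < 1) {c V₀ : ℝ} (hc : 0 ≤ c)
    (hV₀ : 0 ≤ V₀) :
    ∃ M, 0 ≤ M ∧ ∀ v : ℕ → ℝ, v 0 ≤ V₀ → (∀ q, v (q + 1) ≤ ρ * v q + c * decay q) →
      ∀ q, v q ≤ M * decay q := by
  have hρ' : 0 < 1 - ρ := by linarith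
  -- For ρ < r < 1, beyond `N` one has r · `decay q` ≤ `decay (q + 1)`, so a bound M · `decay q` is
  -- inherited once ρ M + c ≤ r M. Up to `N` the uniform bound `W` is used; M is chosen to serve
  -- both ranges.
  obtain ⟨r, hr⟩ : ∃ r, r = (1 + ρ) / 2 := ⟨_, rfl⟩
  have hr0 : 0 < r := by rw [hr]; linarith
  have hr1 : r < 1 := by rw [hr]; linarith
  obtain ⟨N, hN⟩ := exists_nat_gt (r ^ 2 / (1 - r ^ 2))
  have hr2 : 0 < 1 - r ^ 2 := by nlinarith
  obtain ⟨W, hW⟩ : ∃ W, W = V₀ + c / (1 - ρ) := ⟨_, rfl⟩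
  have hW0 : 0 ≤ W := by rw [hW]; positivity
  have hWc : ρ * W + c ≤ W := by
    have : c / (1 - ρ) * (1 - ρ) = c := div_mul_cancel₀ _ hρ'.ne'
    nlinarith
  obtain ⟨M, hM⟩ : ∃ M, M = W * √((N : ℝ) + 1) + c / (r - ρ) := ⟨_, rfl⟩
  have hrρ : 0 < r - ρ := by rw [hr]; linarith
  have hM0 : 0 ≤ M := by rw [hM]; positivity
  refine ⟨M, hM0, fun v h0 hstep => ?_⟩
  have hdec1 : ∀ q, decay q ≤ 1 := fun q => by
    simpa [decay] using decay_antitone (Nat.zero_le q)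
  have hbd : ∀ q, v q ≤ W := by
    intro q
    induction q with
    | zero => exact h0.trans (by rw [hW]; linarith [div_nonneg hc hρ'.le])
    | succ q ih =>
      have := mul_le_mul_of_nonneg_left (hdec1 q) hc
      have := mul_le_mul_of_nonneg_left ih hρ0
      linarith [hstep q]
  have hsmall : ∀ q, q ≤ N → v q ≤ M * decay q := by
    intro q hq
    have h1 : 1 ≤ √((N : ℝ) + 1) * decay q := by
      refine le_trans (le_of_eq ?_) (mul_le_mul_of_nonneg_left (decay_antitone hq) (by positivity))
      unfold decay
      field_simp
    calc v q ≤ W * 1 := by linarith [hbd q]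
      _ ≤ W * (√((N : ℝ) + 1) * decay q) := mul_le_mul_of_nonneg_left h1 hW0
      _ = W * √((N : ℝ) + 1) * decay q := by ring
      _ ≤ M * decay q := mul_le_mul_of_nonneg_right
          (by rw [hM]; linarith [div_nonneg hc hrρ.le]) (decay_pos q).le
  intro q
  induction q with
  | zero => exact hsmall 0 (Nat.zero_le _)
  | succ q ih =>
    rcases le_or_gt (q + 1) N with hq | hq
    · exact hsmall _ hq
    · have h1 : r * decay q ≤ decay (q + 1) := by
        have hqN : (N : ℝ) ≤ q := by exact_mod_cast Nat.lt_succ_iff.1 hq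
        have h2 : r ^ 2 < q * (1 - r ^ 2) := (div_lt_iff₀ hr2).1 (hN.trans_le hqN)
        have : decay q ≤ r⁻¹ * decay (q + 1) := by
          refine decay_le_mul_decay (by positivity) ?_
          rw [inv_pow, inv_mul_eq_div, le_div_iff₀ (by positivity)]
          push_cast
          nlinarith
        calc r * decay q ≤ r * (r⁻¹ * decay (q + 1)) := mul_le_mul_of_nonneg_left this hr0.le
          _ = decay (q + 1) := by field_simp
      have h3 : ρ * M + c ≤ r * M := by
        have : c / (r - ρ) * (r - ρ) = c := div_mul_cancel₀ _ hrρ.ne'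
        have h4 : c / (r - ρ) ≤ M := by rw [hM]; linarith [mul_nonneg hW0 (Real.sqrt_nonneg ((N : ℝ) + 1))]
        nlinarith [mul_le_mul_of_nonneg_right h4 hrρ.le]
      calc v (q + 1) ≤ ρ * (M * decay q) + c * decay q :=
            (hstep q).trans (by linarith [mul_le_mul_of_nonneg_left ih hρ0])
        _ = (ρ * M + c) * decay q := by ring
        _ ≤ r * M * decay q := mul_le_mul_of_nonneg_right h3 (decay_pos q).le
        _ = M * (r * decay q) := by ring
        _ ≤ M * decay (q + 1) := mul_le_mul_of_nonneg_left h1 hM0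

/-- With surplus parameter `η`, surplus-based averaging reaches consensus at the rate of its
perturbations, uniformly over the matrices with the given parameters. -/
def SurplusConsensus (n Q : ℕ) (κ K η : ℝ) : Prop :=
  ∀ Y₀ U : ℝ, 0 ≤ Y₀ → 0 ≤ U →
    ∃ M, 0 ≤ M ∧ ∀ A B C : ℕ → Matrix (Fin n) (Fin n) ℝ, SurplusMatrices A B C κ K Q →
      ∀ y s u : ℕ → Fin n → ℝ,
        (∀ q, y (q + 1) = (A q).mulVec (y q) + η • s q - u q) →
        (∀ q, s (q + 1) = (C q).mulVec (y q) + (B q).mulVec (s q) - η • s q) →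
        (∀ q, ∑ i, y q i + ∑ i, s q i = 0) →
        ‖y 0‖ ≤ Y₀ → ∑ i, |s 0 i| ≤ Y₀ → (∀ q, ‖u q‖ ≤ U * decay q) →
        ∀ q, ‖y q‖ ≤ M * decay q

theorem exists_surplusConsensus {n Q : ℕ} (hn : 0 < n) (hQ : 0 < Q) {κ K : ℝ} (hκ : 0 < κ)
    (hκ1 : κ ≤ 1) (hK : 0 ≤ K) :
    ∃ ηbar : ℝ, 0 < ηbar ∧ ∀ η, 0 < η → η < ηbar → SurplusConsensus n Q κ K η := by
  have : Nonempty (Fin n) := ⟨⟨0, hn⟩⟩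
  have hn1 : (1 : ℝ) ≤ n := by exact_mod_cast hn
  have hQ1 : (1 : ℝ) ≤ Q := by exact_mod_cast hQ
  obtain ⟨K₁, K₂, ηbar, hK₁, hK₂, hηbar, H⟩ :=
    exists_weights_of_small_gain (n := n) (Q := Q) (g := κ / Q) (K := n * K) hn1 hQ1 hκ hκ1
      (by positivity) ((div_le_one (by positivity)).2 (hκ1.trans hQ1)) (by positivity)
  refine ⟨ηbar, hηbar, fun η hη hlt Y₀ U hY₀ hU => ?_⟩
  obtain ⟨hηn, ρ, hρ0, hρ1, hV⟩ := H η hη hlt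
  obtain ⟨M, hM0, hM⟩ := exists_le_mul_decay hρ0 hρ1
    (c := (1 + 2 * Q * K₁) * U) (V₀ := Y₀ + K₁ * (Q * (2 * Y₀)) + K₂ * (Q * (2 * Y₀)))
    (by positivity) (by positivity)
  refine ⟨M, hM0, fun A B C h y s u hy hs hz hy0 hs0 hu q => ?_⟩
  -- The surplus minus its total distributed according to the transported mass. Since Σs = -Σy, this
  -- is the decomposition s = e - (Σy) φ required by the one-step estimates.
  set e : ℕ → Fin n → ℝ := fun q i => s q i - (∑ k, s q k) * massFrom B q i with he
  have hse : ∀ q i, s q i = e q i - (∑ k, y q k) * massFrom B q i := fun q i => by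
    have : ∑ k, y q k = -∑ k, s q k := by linarith [hz q]
    simp only [he, this]; ring
  have he0 : ∀ q, ∑ i, e q i = 0 := fun q => by
    simp only [he, sum_sub_distrib, ← mul_sum, sum_massFrom h.colB, mul_one, sub_self]
  have hDnn : ∀ q, 0 ≤ accSpread A Q q (y q) := fun q => sum_nonneg fun _ _ => spread_nonneg _
  have hEnn : ∀ q, 0 ≤ accAbs B Q q (e q) :=
    fun q => sum_nonneg fun _ _ => sum_nonneg fun _ _ => abs_nonneg _
  have hv := hM (fun q => ‖y q‖ + K₁ * accSpread A Q q (y q) + K₂ * accAbs B Q q (e q)) ?_ ?_ q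
  · have := mul_nonneg hK₁.le (hDnn q)
    have := mul_nonneg hK₂.le (hEnn q)
    linarith
  · have h1 : accSpread A Q 0 (y 0) ≤ Q * (2 * Y₀) :=
      (accSpread_le h.rowA 0 _).trans (mul_le_mul_of_nonneg_left
        ((spread_le_two_mul_norm _).trans (by linarith)) (by positivity))
    have h2 : ∑ i, |e 0 i| ≤ 2 * Y₀ := by
      calc ∑ i, |e 0 i| ≤ ∑ i, (|s 0 i| + |∑ k, s 0 k| * massFrom B 0 i) := by
            refine sum_le_sum fun i _ => (abs_sub _ _).trans ?_
            rw [abs_mul, abs_of_nonneg (massFrom_nonneg h.colB 0 i)]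
        _ = ∑ i, |s 0 i| + |∑ k, s 0 k| := by
            rw [sum_add_distrib, ← mul_sum, sum_massFrom h.colB, mul_one]
        _ ≤ 2 * Y₀ := by linarith [abs_sum_le_sum_abs (s 0) univ]
    have h3 : accAbs B Q 0 (e 0) ≤ Q * (2 * Y₀) :=
      (accAbs_le h.colB 0 _).trans (mul_le_mul_of_nonneg_left h2 (by positivity))
    have := mul_le_mul_of_nonneg_left h1 hK₁.le
    have := mul_le_mul_of_nonneg_left h3 hK₂.le
    linarith
  · intro q
    have a1 := h.norm_step hκ.le hη.le (by simpa using hηn) (q := q) (y := y q) (u := u q) (hse q)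
    have a2 := h.accSpread_surplus_step hQ hκ.le hκ1 hη.le (q := q) (y := y q) (u := u q) (hse q)
    have a3 := h.accAbs_surplus_step hQ hκ.le hη.le (q := q) (y := y q) (hse q) (he0 q) (hs q)
      (e' := e (q + 1)) (fun i => rfl)
    rw [← hy q] at a1 a2
    rw [Fintype.card_fin] at a1 a2 a3
    have b1 := spread_le_accSpread (A := A) hQ q (y q)
    have b2 := sum_abs_le_accAbs (B := B) hQ q (e q)
    have c1 : η * n * spread (y q) ≤ η * n * accSpread A Q q (y q) :=
      mul_le_mul_of_nonneg_left b1 (by positivity)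
    have c2 : η * ∑ i, |e q i| ≤ η * accAbs B Q q (e q) := mul_le_mul_of_nonneg_left b2 hη.le
    have c3 : n * K * spread (y q) ≤ n * K * accSpread A Q q (y q) :=
      mul_le_mul_of_nonneg_left b1 (by positivity)
    have c4 : (Q : ℝ) * (η * ∑ i, |e q i|) ≤ Q * (η * accAbs B Q q (e q)) :=
      mul_le_mul_of_nonneg_left c2 (by positivity)
    have c5 : (Q : ℝ) * (n * K * spread (y q)) ≤ Q * (n * K * accSpread A Q q (y q)) :=
      mul_le_mul_of_nonneg_left c3 (by positivity)
    have := hV ‖y q‖ (accSpread A Q q (y q)) (accAbs B Q q (e q)) ‖y (q + 1)‖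
      (accSpread A Q (q + 1) (y (q + 1))) (accAbs B Q (q + 1) (e (q + 1))) ‖u q‖
      (norm_nonneg _) (hDnn q) (hEnn q) (by linarith) (by linarith) (by linarith)
    refine this.trans (add_le_add_right ?_ _)
    exact (mul_le_mul_of_nonneg_left (hu q) (by positivity)).trans_eq (mul_assoc _ _ _).symm

end ConsensusRate

variable {S : Sizes}

/-! ### Communication over one period -/

section Communication

theorem Sizes.m_pos (S : Sizes) (l : Fin 2) : 0 < S.m l :=
  Nat.pos_of_ne_zero fun h => by
    have h1 := S.d_pos l
    have h2 := S.d_le l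
    rw [h, mul_zero] at h2
    omega

theorem Sizes.window_le (S : Sizes) (l : Fin 2) :
    ∃ k, 0 < k ∧ S.N l * S.m l ≤ k * S.d l ∧ S.R₀ * k ≤ S.R := by
  have hd : (0 : ℚ) < S.d l := by exact_mod_cast S.d_pos l
  refine ⟨⌈(S.N l * S.m l : ℚ) / S.d l⌉₊, ?_, ?_, ?_⟩
  · refine Nat.ceil_pos.2 (div_pos ?_ hd)
    exact_mod_cast Nat.mul_pos (S.N_pos l) (S.m_pos l)
  · have := (div_le_iff₀ hd).1 (Nat.le_ceil ((S.N l * S.m l : ℚ) / S.d l))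
    exact_mod_cast this
  · fin_cases l
    · exact le_max_left _ _
    · exact le_max_right _ _

theorem Sizes.R_pos (S : Sizes) : 0 < S.R := by
  obtain ⟨k, hk, -, h⟩ := S.window_le 0
  exact (Nat.mul_pos S.R₀_pos hk).trans_le h

/-- Every interval of two periods contains a full window in which a given entry is sent. -/
theorem exists_sent_window (l : Fin 2) (r : Fin (S.N l)) (c : Fin (S.m l)) (t₀ : ℕ) :
    ∃ t, t₀ ≤ t ∧ t + S.R₀ ≤ t₀ + 2 * S.R ∧
      ∀ τ, t ≤ τ → τ < t + S.R₀ → Sent S l r c τ := by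
  obtain ⟨k, hk, hkd, hkR⟩ := S.window_le l
  have hR := S.R₀_pos
  have hd := S.d_pos l
  set P := S.N l * S.m l with hP
  have hP0 : 0 < P := Nat.mul_pos (S.N_pos l) (S.m_pos l)
  set v := (r : ℕ) * S.m l + c with hv
  have hvP : v < P := by
    have h1 := r.2
    have h2 := c.2
    calc v < (r : ℕ) * S.m l + S.m l := by omega
      _ = (r + 1) * S.m l := by ring
      _ ≤ P := Nat.mul_le_mul_right _ h1
  -- j₀ = ⌈t₀ / R₀⌉. Window j consists of the times j R₀ + 1, …, (j + 1) R₀, so window j₀ starts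
  -- after t₀, at a delay of at most R₀ ≤ R.
  set j₀ := (t₀ + S.R₀ - 1) / S.R₀ with hj₀
  have hj1 : t₀ ≤ j₀ * S.R₀ := by
    have := Nat.lt_div_mul_add (a := t₀ + S.R₀ - 1) hR
    rw [← hj₀] at this
    omega
  have hj2 : j₀ * S.R₀ + 1 ≤ t₀ + S.R₀ := by
    have := Nat.div_mul_le_self (t₀ + S.R₀ - 1) S.R₀
    rw [← hj₀] at this
    omega
  -- y is the cyclic distance from the first position sent in window j₀ to the entry. Each window
  -- advances by d, so the entry is sent y / d windows later, and y / d < k because y < P ≤ k d.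
  obtain ⟨y, hyP, hy⟩ : ∃ y, y < P ∧ (j₀ * S.d l + y) % P = v := by
    have h1 : j₀ * S.d l % P < P := Nat.mod_lt _ hP0
    have h2 := Nat.div_add_mod (j₀ * S.d l) P
    rcases le_total (j₀ * S.d l % P) v with h | h
    · refine ⟨v - j₀ * S.d l % P, by omega, ?_⟩
      have : j₀ * S.d l + (v - j₀ * S.d l % P) = P * (j₀ * S.d l / P) + v := by omega
      rw [this, Nat.mul_add_mod, Nat.mod_eq_of_lt hvP]
    · rcases h.eq_or_lt with h | h
      · exact ⟨0, hP0, by rw [add_zero, h]⟩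
      · refine ⟨v + P - j₀ * S.d l % P, by omega, ?_⟩
        have : j₀ * S.d l + (v + P - j₀ * S.d l % P) = P * (j₀ * S.d l / P) + (v + P) := by omega
        rw [this, Nat.mul_add_mod, Nat.add_mod_right, Nat.mod_eq_of_lt hvP]
  set i := y / S.d l with hi
  have hik : i < k := Nat.div_lt_of_lt_mul (by rw [mul_comm]; omega)
  have hid : i * S.d l + y % S.d l = y := Nat.div_add_mod' y (S.d l)
  refine ⟨(j₀ + i) * S.R₀ + 1, ?_, ?_, fun τ h1 h2 => ⟨y % S.d l, Nat.mod_lt _ hd, ?_⟩⟩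
  · have : j₀ * S.R₀ ≤ (j₀ + i) * S.R₀ := Nat.mul_le_mul_right _ (Nat.le_add_right _ _)
    omega
  · have h1 : (i + 1) * S.R₀ ≤ S.R := (Nat.mul_le_mul_right _ hik).trans (by rwa [mul_comm])
    have h2 : S.R₀ ≤ S.R := (Nat.le_mul_of_pos_right _ hk).trans hkR
    have h3 : (j₀ + i) * S.R₀ = j₀ * S.R₀ + i * S.R₀ := Nat.add_mul _ _ _
    have h4 : (i + 1) * S.R₀ = i * S.R₀ + S.R₀ := Nat.succ_mul _ _
    omega
  · have : (τ - 1) / S.R₀ = j₀ + i :=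
      Nat.div_eq_of_lt_le (by omega) (by rw [Nat.succ_mul]; omega)
    rw [this, Nat.add_mul, add_assoc, hid, hy]

variable {net : Network S} (l : Fin 2) (r : Fin (S.N l)) (c : Fin (S.m l))

theorem inv_le_inv_card {n : ℕ} {s : Finset (Fin n)} {i : Fin n} (hi : i ∈ s) :
    1 / (n : ℝ) ≤ 1 / (s.card : ℝ) := by
  have h1 : 0 < s.card := card_pos.2 ⟨i, hi⟩
  have h2 : s.card ≤ n := by simpa using s.card_le_univ
  exact one_div_le_one_div_of_le (by exact_mod_cast h1) (by exact_mod_cast h2)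

theorem matA_mem (t : ℕ) : matA net l r c t ∈ Matrix.rowStochastic ℝ (Fin (S.n l)) := by
  refine Matrix.mem_rowStochastic_iff_sum.2 ⟨fun i j => ?_, fun i => ?_⟩
  · simp only [matA, Matrix.of_apply]; split_ifs <;> positivity
  · have : 0 < (inNbrs net l r c t i).card := card_pos.2 ⟨i, by simp [inNbrs]⟩
    simp only [matA, Matrix.of_apply, sum_ite_mem, univ_inter, sum_const, nsmul_eq_mul]
    field_simp

theorem matB_mem (t : ℕ) : matB net l r c t ∈ Matrix.colStochastic ℝ (Fin (S.n l)) := by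
  refine Matrix.mem_colStochastic_iff_sum.2 ⟨fun i j => ?_, fun j => ?_⟩
  · simp only [matB, Matrix.of_apply]; split_ifs <;> positivity
  · have : 0 < (outNbrs net l r c t j).card := card_pos.2 ⟨j, by simp [outNbrs]⟩
    simp only [matB, Matrix.of_apply, sum_ite_mem, univ_inter, sum_const, nsmul_eq_mul]
    field_simp

theorem le_matA {t : ℕ} {i j : Fin (S.n l)}
    (h : j = i ∨ (net t ⟨l, j⟩ ⟨l, i⟩ ∧ Sent S l r c t)) :
    1 / (S.n l : ℝ) ≤ matA net l r c t i j := by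
  have hm : j ∈ inNbrs net l r c t i := by simpa [inNbrs] using h
  simpa only [matA, Matrix.of_apply, if_pos hm] using inv_le_inv_card hm

theorem le_matB {t : ℕ} {i j : Fin (S.n l)}
    (h : i = j ∨ (net t ⟨l, j⟩ ⟨l, i⟩ ∧ Sent S l r c t)) :
    1 / (S.n l : ℝ) ≤ matB net l r c t i j := by
  have hm : i ∈ outNbrs net l r c t j := by simpa [outNbrs] using h
  simpa only [matB, Matrix.of_apply, if_pos hm] using inv_le_inv_card hm

theorem connected_of_sent (hnet : NetworkAssumptions net) {P : ℕ → Fin (S.n l) → Fin (S.n l) → Prop}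
    (hP : ∀ τ a b, net τ ⟨l, a⟩ ⟨l, b⟩ → Sent S l r c τ → P τ a b) (t₀ : ℕ) (i j : Fin (S.n l)) :
    Relation.ReflTransGen (fun a b => ∃ τ, t₀ ≤ τ ∧ τ < t₀ + 2 * S.R ∧ P τ a b) i j := by
  obtain ⟨t, h1, h2, h3⟩ := exists_sent_window l r c t₀
  refine Relation.ReflTransGen.mono (fun a b ⟨τ, k1, k2, k3⟩ => ?_) _ _ (hnet.joint t l i j)
  exact ⟨τ, by omega, by omega, hP τ a b k3 (h3 τ k1 k2)⟩

/-- As S₀ ≤ R₀, a window in which the entry is sent also contains a time at which the agent hears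
from the rival. -/
theorem exists_crossNbrs (hnet : NetworkAssumptions net) {j : Fin 2} (hj : j ≠ l)
    (i : Fin (S.n l)) (r : Fin (S.N j)) (c : Fin (S.m j)) (t₀ : ℕ) :
    ∃ τ, t₀ ≤ τ ∧ τ < t₀ + 2 * S.R ∧ (crossNbrs net l i j r c τ).card ≠ 0 := by
  classical
  obtain ⟨t, h1, h2, h3⟩ := exists_sent_window j r c t₀
  obtain ⟨S₀, -, hS₀, hc⟩ := hnet.cross
  obtain ⟨τ, k1, k2, j', i', hj', hn⟩ := hc t l i
  obtain rfl : j' = j := by omega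
  refine ⟨τ, by omega, by omega, ?_⟩
  exact (card_pos.2 ⟨i', by simp [crossNbrs, hn, h3 τ k1 (by omega)]⟩).ne'

/-- Over one period, the updates of an entry form a system of surplus matrices. -/
theorem surplusMatrices (hnet : NetworkAssumptions net) :
    SurplusMatrices (fun q => prodFrom (matA net l r c) (q * S.R) S.R)
      (fun q => prodFrom (matB net l r c) (q * S.R) S.R)
      (fun q => lowerFrom (matA net l r c) (matB net l r c) (q * S.R) S.R)
      ((1 / (S.n l : ℝ)) ^ (2 * S.R * S.n l)) (S.n l * S.R) (2 * S.n l) := by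
  have hδ0 : (0 : ℝ) ≤ 1 / (S.n l : ℝ) := by positivity
  have hδ1 : 1 / (S.n l : ℝ) ≤ 1 := by
    have : (1 : ℝ) ≤ S.n l := by exact_mod_cast S.n_pos l
    exact (div_le_one (by positivity)).2 this
  have hA : ∀ t i j, 0 ≤ matA net l r c t i j := fun t i j =>
    Matrix.nonneg_of_mem_rowStochastic (matA_mem l r c t)
  have hB : ∀ t i j, 0 ≤ matB net l r c t i j := fun t i j =>
    Matrix.nonneg_of_mem_colStochastic (matB_mem l r c t)
  -- Q = 2 n periods are the same as n blocks of 2 R steps, the length over which the edges carrying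
  -- the entry are jointly strongly connected.
  have hlen : 2 * S.n l * S.R = 2 * S.R * S.n l := by ring
  refine ⟨fun q => prodFrom_mem (matA_mem l r c) _ _, fun q => prodFrom_mem (matB_mem l r c) _ _,
    fun q i j => ?_, fun q i j => ?_, fun q k hk i => ?_,
    fun q => lowerFrom_mulVec_one (matA_mem l r c) _ _, fun q j => ?_⟩
  · rw [prodFrom_period, hlen]
    simpa using pow_le_prodFrom_of_connected hδ0 hA (fun t i => le_matA l r c (Or.inl rfl))
      (connected_of_sent l r c hnet fun τ a b h1 h2 => le_matA l r c (Or.inr ⟨h1, h2⟩))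
      (q * S.R) i j
  · rw [prodFrom_period, hlen]
    simpa using pow_le_prodFrom_of_connected hδ0 hB (fun t i => le_matB l r c (Or.inl rfl))
      (connected_of_sent l r c hnet fun τ a b h1 h2 => le_matB l r c (Or.inr ⟨h1, h2⟩))
      (q * S.R) i j
  · rw [prodFrom_period]
    refine le_trans (pow_le_pow_of_le_one hδ0 hδ1 ?_)
      (pow_le_prodFrom_diag hδ0 hB (fun t i => le_matB l r c (Or.inl rfl)) _ _ i)
    rw [← hlen]
    exact Nat.mul_le_mul_right _ hk
  · simpa using sum_abs_lowerFrom_le (matA_mem l r c) (matB_mem l r c) (q * S.R) S.R j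

end Communication

/-! ### Costs of the discretized game -/

section Costs

theorem sum_fin_two_eq {M : Type*} [AddCommMonoid M] (l : Fin 2) (f : Fin 2 → M) :
    ∑ j, f j = f l + f (l + 1) := by
  fin_cases l
  · simp [Fin.sum_univ_two]
  · simp [Fin.sum_univ_two, add_comm]

theorem add_one_ne_self (l : Fin 2) : l + 1 ≠ l := by fin_cases l <;> decide

variable {G : Game S} {L : Fin 2 → Fin 2 → NNReal} {pts : Points S}

/-- `F` is Lipschitz in the actions, with constant `K j` in the action of subnetwork `j`. -/
def ActionLipschitz (G : Game S) (K : Fin 2 → ℝ)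
    (F : (∀ j, Act S j) → (Fin 2 → ℝ) → ℝ) : Prop :=
  ∀ x x' : ∀ j, Act S j, ∀ θ ∈ G.Types, |F x θ - F x' θ| ≤ ∑ j, K j * ‖x j - x' j‖

theorem actionLipschitz_f (hG : G.Assumptions L) (l : Fin 2) (i : Fin (S.n l)) :
    ActionLipschitz G (fun j => L l j) (G.f l i) := by
  intro x x' θ hθ
  obtain ⟨y, hy⟩ : ∃ y, y = Function.update x 0 (x' 0) := ⟨_, rfl⟩
  have h0 := (hG.lipschitz_action l i 0 x θ hθ).dist_le_mul (x 0) (x' 0)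
  have h1 := (hG.lipschitz_action l i 1 y θ hθ).dist_le_mul (x 1) (x' 1)
  have e1 : Function.update y 1 (x 1) = y := by
    have : x 1 = y 1 := by rw [hy, Function.update_of_ne (by decide)]
    rw [this, Function.update_eq_self]
  have e2 : Function.update y 1 (x' 1) = x' := by
    funext j
    fin_cases j
    · simp [hy]
    · simp
  simp only [Function.update_eq_self, e1, e2, ← hy, dist_eq_norm] at h0 h1
  rw [Fin.sum_univ_two]
  exact (abs_sub_le _ (G.f l i y θ) _).trans (add_le_add h0 h1)

theorem actionLipschitz_cost (hG : G.Assumptions L) (l : Fin 2) :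
    ActionLipschitz G (fun j => L l j) (G.cost l) := by
  intro x x' θ hθ
  have hn : (0 : ℝ) < S.n l := by exact_mod_cast S.n_pos l
  have h1 : |∑ i, (G.f l i x θ - G.f l i x' θ)| ≤ S.n l * ∑ j, (L l j : ℝ) * ‖x j - x' j‖ := by
    refine (abs_sum_le_sum_abs _ _).trans ?_
    refine (sum_le_sum fun i (_ : i ∈ univ) => actionLipschitz_f hG l i x x' θ hθ).trans_eq ?_
    rw [sum_const, card_univ, Fintype.card_fin, nsmul_eq_mul]
  rw [Game.cost, Game.cost, ← mul_sub, ← sum_sub_distrib, abs_mul, abs_of_pos (by positivity),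
    one_div, inv_mul_le_iff₀ hn]
  exact h1

theorem typeAt_mem (hD : IsDiscretization G pts) (κ : ∀ l, Fin (S.N l)) :
    (fun j => typeAt pts j (κ j)) ∈ G.Types := by
  intro l _
  constructor
  · rw [← hD.first l]; exact (hD.strictMono l).monotone (Fin.zero_le _)
  · rw [← hD.last l]; exact (hD.strictMono l).monotone (Fin.le_last _)

theorem prob_nonneg (hG : G.Assumptions L) (hD : IsDiscretization G pts)
    (κ : ∀ l, Fin (S.N l)) : 0 ≤ prob G pts κ := by
  refine MeasureTheory.setIntegral_nonneg
    (MeasurableSet.univ_pi fun l => measurableSet_Ioc) fun θ hθ => hG.density_nonneg θ fun l _ => ?_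
  have h := hθ l (Set.mem_univ l)
  constructor
  · rw [← hD.first l]
    exact ((hD.strictMono l).monotone (Fin.zero_le _)).trans h.1.le
  · rw [← hD.last l]
    exact h.2.trans ((hD.strictMono l).monotone (Fin.le_last _))

theorem probMarginal_pos (hD : IsDiscretization G pts) (l : Fin 2) (r : Fin (S.N l)) :
    0 < probMarginal G pts l r := by
  rw [hD.uniform]
  have : (0 : ℝ) < S.N l := by exact_mod_cast S.N_pos l
  positivity

/-- Given the own type r, only the own action at r matters, whereas the rival may have any type; the
hypotheses `ha` and `hb` reflect this asymmetry. The conditional probabilities add up to 1. -/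
theorem abs_expCost_sub_le (hG : G.Assumptions L) (hD : IsDiscretization G pts)
    {K : Fin 2 → ℝ} (hK : ∀ j, 0 ≤ K j) {F : (∀ j, Act S j) → (Fin 2 → ℝ) → ℝ}
    (hF : ActionLipschitz G K F) {l : Fin 2} {r : Fin (S.N l)} {σ σ' : ∀ j, Strat S j} {a b : ℝ}
    (ha : ‖σ l r - σ' l r‖ ≤ a) (hb : ∀ r', ‖σ (l + 1) r' - σ' (l + 1) r'‖ ≤ b) :
    |expCost G pts F l r σ - expCost G pts F l r σ'| ≤ K l * a + K (l + 1) * b := by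
  have hp := probMarginal_pos hD l r
  rw [expCost, expCost, ← sum_sub_distrib]
  calc _ ≤ ∑ κ : (∀ j, Fin (S.N j)) with κ l = r,
        (K l * a + K (l + 1) * b) * (prob G pts κ / probMarginal G pts l r) := by
        refine (abs_sum_le_sum_abs _ _).trans (sum_le_sum fun κ hκ => ?_)
        have hq : 0 ≤ prob G pts κ / probMarginal G pts l r :=
          div_nonneg (prob_nonneg hG hD κ) hp.le
        rw [← sub_mul, abs_mul, abs_of_nonneg hq]
        refine mul_le_mul_of_nonneg_right ?_ hq
        refine (hF _ _ _ (typeAt_mem hD κ)).trans ?_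
        rw [sum_fin_two_eq l]
        obtain rfl := (mem_filter.1 hκ).2
        exact add_le_add (mul_le_mul_of_nonneg_left ha (hK _))
          (mul_le_mul_of_nonneg_left (hb _) (hK _))
    _ = K l * a + K (l + 1) * b := by
        rw [← mul_sum, ← sum_div]
        change _ * (probMarginal G pts l r / _) = _
        rw [div_self hp.ne', mul_one]

/-- Expectation of a cost over both types. -/
def totalCost (G : Game S) (pts : Points S) (F : (∀ j, Act S j) → (Fin 2 → ℝ) → ℝ)
    (σ : ∀ j, Strat S j) : ℝ :=
  ∑ κ : (∀ j, Fin (S.N j)), F (fun j => σ j (κ j)) (fun j => typeAt pts j (κ j)) * prob G pts κ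

/-- Equal marginal probabilities 1/N undo the conditioning. Both subnetworks' mean costs thus become
expectations under the same joint law, to which the zero-sum property applies. -/
theorem mean_expCost (hD : IsDiscretization G pts) (F : (∀ j, Act S j) → (Fin 2 → ℝ) → ℝ)
    (l : Fin 2) (σ : ∀ j, Strat S j) :
    (1 / (S.N l : ℝ)) * ∑ r, expCost G pts F l r σ = totalCost G pts F σ := by
  have hN : (0 : ℝ) < S.N l := by exact_mod_cast S.N_pos l
  rw [totalCost, ← sum_fiberwise univ (fun κ : (∀ j, Fin (S.N j)) => κ l), mul_sum]
  refine sum_congr rfl fun r _ => ?_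
  rw [expCost, mul_sum]
  refine sum_congr rfl fun κ _ => ?_
  rw [hD.uniform]
  field_simp

theorem expCost_cost (l : Fin 2) (r : Fin (S.N l)) (σ : ∀ j, Strat S j) :
    expCost G pts (G.cost l) l r σ =
      (1 / (S.n l : ℝ)) * ∑ i, expCost G pts (G.f l i) l r σ := by
  simp only [expCost, Game.cost]
  rw [sum_comm, mul_sum]
  refine sum_congr rfl fun κ _ => ?_
  rw [← sum_mul, mul_assoc]

theorem payoff_eq (hD : IsDiscretization G pts) (σ : ∀ j, Strat S j) :
    payoff G pts σ = totalCost G pts (G.cost 0) σ := mean_expCost hD _ 0 σ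

theorem totalCost_add (hG : G.Assumptions L) (hD : IsDiscretization G pts)
    (σ : ∀ j, Strat S j) :
    totalCost G pts (G.cost 0) σ + totalCost G pts (G.cost 1) σ = 0 := by
  rw [totalCost, totalCost, ← sum_add_distrib]
  refine sum_eq_zero fun κ _ => ?_
  rw [← add_mul, hG.zero_sum _ _ (typeAt_mem hD κ), zero_mul]

end Costs

/-! ### The penalty -/

section Penalty

theorem proj_spec {m : ℕ} {C : Set (EuclideanSpace ℝ (Fin m))} (hC : IsCompact C)
    (hne : C.Nonempty) (x : EuclideanSpace ℝ (Fin m)) :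
    proj C x ∈ C ∧ ∀ z ∈ C, ‖x - proj C x‖ ≤ ‖x - z‖ := by
  obtain ⟨y, hy, hxy⟩ := hC.exists_infDist_eq_dist hne x
  refine Classical.epsilon_spec (p := fun y => y ∈ C ∧ ∀ z ∈ C, ‖x - y‖ ≤ ‖x - z‖)
    ⟨y, hy, fun z hz => ?_⟩
  rw [← dist_eq_norm, ← dist_eq_norm, ← hxy]
  exact Metric.infDist_le_dist_of_mem hz

theorem inner_proj_nonpos {m : ℕ} {C : Set (EuclideanSpace ℝ (Fin m))} (hC : IsCompact C)
    (hne : C.Nonempty) (hc : Convex ℝ C) (x : EuclideanSpace ℝ (Fin m)) {z} (hz : z ∈ C) :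
    inner ℝ (x - proj C x) (z - proj C x) ≤ 0 := by
  obtain ⟨h1, h2⟩ := proj_spec hC hne x
  have : Nonempty C := hne.to_subtype
  refine (norm_eq_iInf_iff_real_inner_le_zero hc h1).1 (le_antisymm ?_ ?_) z hz
  · exact le_ciInf fun w => h2 w w.2
  · exact ciInf_le ⟨0, by rintro _ ⟨w, rfl⟩; exact norm_nonneg _⟩ (⟨proj C x, h1⟩ : C)

variable {G : Game S} {L : Fin 2 → Fin 2 → NNReal} {E : Fin 2 → ℝ}

theorem penalty_le (hG : G.Assumptions L) {l : Fin 2} (hE : 0 ≤ E l) (x y : Act S l) :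
    penalty G E l x ≤ penalty G E l y + E l * ‖x - y‖ := by
  obtain ⟨-, h2⟩ := proj_spec (hG.compact l) (hG.nonempty l) x
  obtain ⟨h1', -⟩ := proj_spec (hG.compact l) (hG.nonempty l) y
  rw [penalty, penalty, ← mul_add]
  refine mul_le_mul_of_nonneg_left ((h2 _ h1').trans ?_) hE
  have := norm_sub_le_norm_sub_add_norm_sub x y (proj (G.X l) y)
  linarith

theorem norm_penaltyGrad_le {l : Fin 2} (hE : 0 ≤ E l) (x : Act S l) :
    ‖penaltyGrad G E l x‖ ≤ E l := by
  rw [penaltyGrad, norm_smul, Real.norm_of_nonneg (by positivity)]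
  rcases eq_or_ne ‖x - proj (G.X l) x‖ 0 with h | h
  · rwa [h, mul_zero]
  · rw [div_mul_cancel₀ _ h]

/-- The subgradient inequality of the penalty at points z where it vanishes. With P the projection
of x, obtuseness of the angle at P gives ‖x - P‖² ≤ ⟨x - P, x - z⟩. -/
theorem penalty_le_inner (hG : G.Assumptions L) {l : Fin 2} (hE : 0 ≤ E l) (x : Act S l)
    {z : Act S l} (hz : z ∈ G.X l) : penalty G E l x ≤ inner ℝ (penaltyGrad G E l x) (x - z) := by
  have h := inner_proj_nonpos (hG.compact l) (hG.nonempty l) (hG.convex l) x hz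
  set P := proj (G.X l) x with hP
  have h2 : ‖x - P‖ ^ 2 ≤ inner ℝ (x - P) (x - z) := by
    have : x - z = (x - P) - (z - P) := by abel
    rw [this, inner_sub_right, real_inner_self_eq_norm_sq]
    linarith
  rw [penalty, penaltyGrad, inner_smul_left, ← hP]
  rcases eq_or_ne ‖x - P‖ 0 with h0 | h0
  · simp [h0]
  · have := mul_le_mul_of_nonneg_left h2 (div_nonneg hE (norm_nonneg (x - P)))
    refine le_trans (le_of_eq ?_) this
    field_simp

end Penalty

/-! ### Optimality gaps -/

section Gaps

variable {G : Game S} {L : Fin 2 → Fin 2 → NNReal} {pts : Points S} {E : Fin 2 → ℝ}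

/-- Loss of subnetwork `l`, penalty included, from playing `x` against an equilibrium. -/
def gap (G : Game S) (pts : Points S) (E : Fin 2 → ℝ) (σstar : ∀ l, Strat S l) (l : Fin 2)
    (x : Strat S l) : ℝ :=
  totalCost G pts (G.cost l) (Function.update σstar l x) + meanPenalty G E l x -
    totalCost G pts (G.cost l) σstar

/-- Exactness of the penalty: projecting the action at one type onto the action set changes the cost
by at most L_ll times the distance, which the penalty dominates, and the projected action is an
admissible deviation from equilibrium. -/
theorem gap_nonneg (hG : G.Assumptions L) (hD : IsDiscretization G pts)
    (hE : ∀ l, (L l l : ℝ) < E l) {σstar : ∀ l, Strat S l} (hσ : IsDBNE G pts σstar) (l : Fin 2)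
    (x : Strat S l) : 0 ≤ gap G pts E σstar l x := by
  rw [gap, ← mean_expCost hD _ l, ← mean_expCost hD _ l, meanPenalty, ← mul_add, ← mul_sub,
    ← sum_add_distrib, ← sum_sub_distrib]
  refine mul_nonneg (by positivity) (sum_nonneg fun r _ => ?_)
  obtain ⟨hP, -⟩ := proj_spec (hG.compact l) (hG.nonempty l) (x r)
  have h1 := (hσ l r).2 _ hP
  have h2 := abs_expCost_sub_le hG hD (fun j => NNReal.coe_nonneg (L l j)) (actionLipschitz_cost hG l) (r := r)
    (σ := setAction σstar l r (proj (G.X l) (x r))) (σ' := Function.update σstar l x)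
    (a := ‖x r - proj (G.X l) (x r)‖) (b := 0)
    (by simp [setAction, norm_sub_rev])
    (fun r' => by simp [setAction])
  have h3 : (L l l : ℝ) * ‖x r - proj (G.X l) (x r)‖ ≤ penalty G E l (x r) :=
    mul_le_mul_of_nonneg_right (hE l).le (norm_nonneg _)
  have h4 := (abs_le.1 h2).2
  linarith

/-- Test the subgradient inequality at x + g. -/
theorem norm_le_of_isSubgradient {m : ℕ} {φ : EuclideanSpace ℝ (Fin m) → ℝ} {K : ℝ} (hK : 0 ≤ K)
    (hφ : ∀ x y, φ y - φ x ≤ K * ‖y - x‖) {x g} (h : IsSubgradient φ x g) : ‖g‖ ≤ K := by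
  have h1 := h (x + g)
  have h2 := hφ x (x + g)
  rw [add_sub_cancel_left, real_inner_self_eq_norm_sq] at h1
  rw [add_sub_cancel_left] at h2
  by_contra! hlt
  nlinarith [norm_nonneg g]

theorem norm_subgradient_expCost_le (hG : G.Assumptions L) (hD : IsDiscretization G pts)
    {l : Fin 2} {i : Fin (S.n l)} {r : Fin (S.N l)} {V : ∀ j, Strat S j} {x w : Act S l}
    (hw : IsSubgradient (fun y => expCost G pts (G.f l i) l r (setAction V l r y)) x w) :
    ‖w‖ ≤ L l l := by
  refine norm_le_of_isSubgradient (NNReal.coe_nonneg _) (fun x y => ?_) hw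
  have := abs_expCost_sub_le hG hD (fun j => NNReal.coe_nonneg (L l j)) (actionLipschitz_f hG l i) (r := r)
    (σ := setAction V l r y) (σ' := setAction V l r x) (a := ‖y - x‖) (b := 0)
    (by simp [setAction])
    (fun r' => by simp [setAction])
  simpa using (abs_le.1 this).2

/-- The update direction of an agent with view `V` is an approximate subgradient at the profile
`x` close to `V`. -/
theorem sub_le_inner_direction (hG : G.Assumptions L) (hD : IsDiscretization G pts)
    {l : Fin 2} (hE : 0 ≤ E l) {i : Fin (S.n l)} {r : Fin (S.N l)} {V x : ∀ j, Strat S j}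
    {w z : Act S l}
    (hw : IsSubgradient (fun y => expCost G pts (G.f l i) l r (setAction V l r y)) (V l r) w)
    {σl : Strat S l} (hz : z = σl r) (hzX : z ∈ G.X l) {ε : ℝ} (ha : ‖V l r - x l r‖ ≤ ε)
    (hb : ∀ r', ‖V (l + 1) r' - x (l + 1) r'‖ ≤ ε) :
    expCost G pts (G.f l i) l r x - expCost G pts (G.f l i) l r (Function.update x l σl) +
        penalty G E l (x l r) ≤
      inner ℝ (w + penaltyGrad G E l (V l r)) (x l r - z) +
        2 * (L l l + L l (l + 1) + E l) * ε := by
  have hne := add_one_ne_self l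
  have h1 := hw z
  have hVV : setAction V l r (V l r) = V := by simp [setAction]
  simp only [hVV] at h1
  have h2 := (abs_le.1 (abs_expCost_sub_le hG hD (fun j => NNReal.coe_nonneg (L l j)) (actionLipschitz_f hG l i)
    ha hb)).1
  have h3 := (abs_le.1 (abs_expCost_sub_le hG hD (fun j => NNReal.coe_nonneg (L l j)) (actionLipschitz_f hG l i)
    (r := r) (σ := setAction V l r z) (σ' := Function.update x l σl) (a := 0) (b := ε)
    (by simp [setAction, hz])
    (fun r' => by simpa [setAction, Function.update_of_ne hne] using hb r'))).2
  have h4 := penalty_le_inner (E := E) hG hE (V l r) hzX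
  have h5 := penalty_le (E := E) hG hE (x l r) (V l r)
  have hwn := norm_subgradient_expCost_le hG hD hw
  have hpn := norm_penaltyGrad_le (G := G) hE (V l r)
  have hε : 0 ≤ ε := (norm_nonneg _).trans ha
  have h6 : inner ℝ (w + penaltyGrad G E l (V l r)) (V l r - x l r) ≤ (L l l + E l) * ε :=
    (real_inner_le_norm _ _).trans (mul_le_mul ((norm_add_le _ _).trans (add_le_add hwn hpn)) ha
      (norm_nonneg _) (add_nonneg (NNReal.coe_nonneg _) hE))
  have h7 : inner ℝ (w + penaltyGrad G E l (V l r)) (x l r - z) =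
      inner ℝ w (V l r - z) + inner ℝ (penaltyGrad G E l (V l r)) (V l r - z) -
        inner ℝ (w + penaltyGrad G E l (V l r)) (V l r - x l r) := by
    rw [← inner_add_left, ← inner_sub_right]
    congr 1; abel
  have h8 : inner ℝ (z - V l r) w = -inner ℝ w (V l r - z) := by
    rw [real_inner_comm, ← neg_sub, inner_neg_right]
  have h9 : E l * ‖x l r - V l r‖ ≤ E l * ε := by
    rw [norm_sub_rev]; exact mul_le_mul_of_nonneg_left ha hE
  -- Passing from V to x costs (L_ll + L_{l,l+1}) ε in the cost at x, L_{l,l+1} ε in the cost at the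
  -- deviation, (L_ll + E_l) ε in the inner product and E_l ε in the penalty.
  linarith

end Gaps

/-! ### Runs of the algorithm -/

theorem stepsize_pos {a₀ : ℝ} (ha : 0 < a₀) (q : ℕ) : 0 < stepsize a₀ q := by
  unfold stepsize
  split_ifs with h
  · exact ha
  · have : (0 : ℝ) < q := by exact_mod_cast Nat.pos_of_ne_zero h
    positivity

theorem stepsize_le {a₀ : ℝ} (ha : 0 < a₀) (q : ℕ) : stepsize a₀ q ≤ (a₀ + 2) * decay q := by
  unfold stepsize
  split_ifs with h
  · subst h
    simp [decay]
  · have hq : (1 : ℝ) ≤ q := by exact_mod_cast Nat.one_le_iff_ne_zero.2 h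
    have h1 : √((q : ℝ) + 1) ≤ 2 * √q := by
      rw [Real.sqrt_le_left (by positivity), mul_pow, Real.sq_sqrt (by positivity)]
      linarith
    have h2 : 1 / √(q : ℝ) ≤ 2 * decay q := by
      unfold decay
      rw [mul_one_div, div_le_div_iff₀ (by positivity) (by positivity)]
      linarith
    nlinarith [decay_pos q]

theorem norm_le_mul_of_forall_abs_le {m : ℕ} (v : EuclideanSpace ℝ (Fin m)) {b : ℝ}
    (hb : 0 ≤ b) (h : ∀ c, |v c| ≤ b) : ‖v‖ ≤ m * b := by
  rw [EuclideanSpace.norm_eq, Real.sqrt_le_left (by positivity)]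
  calc ∑ c, ‖v c‖ ^ 2 ≤ ∑ _c : Fin m, b ^ 2 :=
        sum_le_sum fun c _ => pow_le_pow_left₀ (norm_nonneg _) (h c) 2
    _ = m * b ^ 2 := by simp
    _ ≤ (m * b) ^ 2 := by
        rw [mul_pow]
        refine mul_le_mul_of_nonneg_right ?_ (sq_nonneg b)
        exact_mod_cast Nat.le_self_pow two_ne_zero m

namespace Trajectory

variable (Z : Trajectory S)

/-- States of the agents of a subnetwork, for one entry. -/
def stateVec (l : Fin 2) (r : Fin (S.N l)) (c : Fin (S.m l)) (t : ℕ) : Fin (S.n l) → ℝ :=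
  fun i => Z.σ l i t r c

/-- Surpluses of the agents of a subnetwork, for one entry. -/
def surplusVec (l : Fin 2) (r : Fin (S.N l)) (c : Fin (S.m l)) (t : ℕ) : Fin (S.n l) → ℝ :=
  fun i => Z.s l i t r c

/-- Average update direction of a subnetwork at the start of period `q`. -/
def meanGrad (G : Game S) (E : Fin 2 → ℝ) (l : Fin 2) (q : ℕ) : Strat S l :=
  fun r => (1 / (S.n l : ℝ)) • ∑ i, Z.grad G E l i (q * S.R) r

theorem avg_apply (l : Fin 2) (t : ℕ) (r : Fin (S.N l)) (c : Fin (S.m l)) :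
    Z.avg l t r c =
      (1 / (S.n l : ℝ)) * (∑ i, Z.stateVec l r c t i + ∑ i, Z.surplusVec l r c t i) := by
  simp [avg, stateVec, surplusVec, sum_add_distrib, mul_add]

theorem meanGrad_apply (G : Game S) (E : Fin 2 → ℝ) (l : Fin 2) (q : ℕ) (r : Fin (S.N l))
    (c : Fin (S.m l)) :
    Z.meanGrad G E l q r c = (1 / (S.n l : ℝ)) * ∑ i, Z.grad G E l i (q * S.R) r c := by
  simp [meanGrad]

namespace IsRun

variable {Z} {G : Game S} {L : Fin 2 → Fin 2 → NNReal} {pts : Points S} {net : Network S}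
  {E : Fin 2 → ℝ} {η a₀ : ℝ} {x₀ : ∀ l, Strat S l} (hZ : Z.IsRun G pts net E η a₀ x₀)
include hZ

theorem stateVec_succ (l : Fin 2) (r : Fin (S.N l)) (c : Fin (S.m l)) (t : ℕ) :
    Z.stateVec l r c (t + 1) = (matA net l r c t).mulVec (Z.stateVec l r c t) +
      if t % S.R = S.R - 1 then η • Z.surplusVec l r c (S.R * (t / S.R)) -
        stepsize a₀ (t / S.R) • (fun i => Z.grad G E l i (S.R * (t / S.R)) r c) else 0 := by
  funext i
  have h := congrFun (hZ.update l r c t) (Sum.inl i)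
  simp only [z, matM, matF, Matrix.fromBlocks_mulVec, Pi.add_apply, Sum.elim_inl] at h
  rw [stateVec, h]
  simp only [Sum.elim_comp_inl, Sum.elim_comp_inr, Matrix.zero_mulVec]
  split_ifs
  · simp [surplusVec]; rfl
  · simp; rfl

theorem surplusVec_succ (l : Fin 2) (r : Fin (S.N l)) (c : Fin (S.m l)) (t : ℕ) :
    Z.surplusVec l r c (t + 1) = (1 - matA net l r c t).mulVec (Z.stateVec l r c t) +
      (matB net l r c t).mulVec (Z.surplusVec l r c t) -
      if t % S.R = S.R - 1 then η • Z.surplusVec l r c (S.R * (t / S.R)) else 0 := by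
  funext i
  have h := congrFun (hZ.update l r c t) (Sum.inr i)
  simp only [z, matM, matF, Matrix.fromBlocks_mulVec, Pi.add_apply, Sum.elim_inr] at h
  rw [surplusVec, h]
  simp only [Sum.elim_comp_inl, Sum.elim_comp_inr]
  split_ifs
  · simp [surplusVec, Matrix.neg_mulVec, sub_eq_add_neg]; rfl
  · simp; rfl

theorem vec_within (l : Fin 2) (r : Fin (S.N l)) (c : Fin (S.m l)) (q : ℕ) {k : ℕ}
    (hk : k < S.R) :
    Z.stateVec l r c (q * S.R + k) =
        (prodFrom (matA net l r c) (q * S.R) k).mulVec (Z.stateVec l r c (q * S.R)) ∧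
      Z.surplusVec l r c (q * S.R + k) =
        (lowerFrom (matA net l r c) (matB net l r c) (q * S.R) k).mulVec
            (Z.stateVec l r c (q * S.R)) +
          (prodFrom (matB net l r c) (q * S.R) k).mulVec (Z.surplusVec l r c (q * S.R)) := by
  induction k with
  | zero => simp [prodFrom, lowerFrom]
  | succ k ih =>
    obtain ⟨h1, h2⟩ := ih (by omega)
    have hmod : (q * S.R + k) % S.R ≠ S.R - 1 := by
      rw [Nat.mul_add_mod_of_lt (by omega : k < S.R)]; omega
    constructor
    · rw [← add_assoc, hZ.stateVec_succ, if_neg hmod, h1, prodFrom, Matrix.mulVec_mulVec, add_zero]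
    · rw [← add_assoc, hZ.surplusVec_succ, if_neg hmod, h1, h2, prodFrom, lowerFrom, sub_zero,
        Matrix.mulVec_add, Matrix.add_mulVec, Matrix.mulVec_mulVec, Matrix.mulVec_mulVec,
        Matrix.mulVec_mulVec, add_assoc]

/-- Feedback and gradient are evaluated at the start of the period but added only at its last step,
so they are not mixed by the matrices of that period. -/
theorem vec_period (l : Fin 2) (r : Fin (S.N l)) (c : Fin (S.m l)) (q : ℕ) :
    Z.stateVec l r c ((q + 1) * S.R) =
        (prodFrom (matA net l r c) (q * S.R) S.R).mulVec (Z.stateVec l r c (q * S.R)) +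
          η • Z.surplusVec l r c (q * S.R) -
          stepsize a₀ q • (fun i => Z.grad G E l i (q * S.R) r c) ∧
      Z.surplusVec l r c ((q + 1) * S.R) =
        (lowerFrom (matA net l r c) (matB net l r c) (q * S.R) S.R).mulVec
            (Z.stateVec l r c (q * S.R)) +
          (prodFrom (matB net l r c) (q * S.R) S.R).mulVec (Z.surplusVec l r c (q * S.R)) -
          η • Z.surplusVec l r c (q * S.R) := by
  have hR := S.R_pos
  obtain ⟨k, hk⟩ : ∃ k, S.R = k + 1 := ⟨S.R - 1, by omega⟩
  obtain ⟨h1, h2⟩ := hZ.vec_within l r c q (k := k) (by omega)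
  have hmod : (q * S.R + k) % S.R = S.R - 1 := by
    rw [Nat.mul_add_mod_of_lt (by omega : k < S.R)]; omega
  have hdiv : (q * S.R + k) / S.R = q := Nat.div_eq_of_lt_le (by omega) (by rw [Nat.succ_mul]; omega)
  have ht : (q + 1) * S.R = q * S.R + k + 1 := by rw [Nat.succ_mul]; omega
  have hprod : ∀ A : ℕ → Matrix (Fin (S.n l)) (Fin (S.n l)) ℝ, prodFrom A (q * S.R) S.R =
      A (q * S.R + k) * prodFrom A (q * S.R) k := fun A => by
    have : ∀ t n, n = k + 1 → prodFrom A t n = A (t + k) * prodFrom A t k := by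
      rintro t n rfl; rfl
    exact this _ _ hk
  have hlow : ∀ A B : ℕ → Matrix (Fin (S.n l)) (Fin (S.n l)) ℝ, lowerFrom A B (q * S.R) S.R =
      (1 - A (q * S.R + k)) * prodFrom A (q * S.R) k +
        B (q * S.R + k) * lowerFrom A B (q * S.R) k := fun A B => by
    have : ∀ t n, n = k + 1 → lowerFrom A B t n =
        (1 - A (t + k)) * prodFrom A t k + B (t + k) * lowerFrom A B t k := by
      rintro t n rfl; rfl
    exact this _ _ hk
  constructor
  · rw [ht, hZ.stateVec_succ, if_pos hmod, hdiv, h1, Matrix.mulVec_mulVec, mul_comm S.R q, hprod,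
      add_sub_assoc]
  · rw [ht, hZ.surplusVec_succ, if_pos hmod, hdiv, h1, h2, mul_comm S.R q, hprod, hlow,
      Matrix.mulVec_add, Matrix.add_mulVec, Matrix.mulVec_mulVec, Matrix.mulVec_mulVec,
      Matrix.mulVec_mulVec, add_assoc]

end IsRun

end Trajectory

namespace Trajectory

namespace IsRun

variable {Z : Trajectory S} {G : Game S} {L : Fin 2 → Fin 2 → NNReal} {pts : Points S}
  {net : Network S} {E : Fin 2 → ℝ} {η a₀ : ℝ} {x₀ : ∀ l, Strat S l}
  (hZ : Z.IsRun G pts net E η a₀ x₀)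
include hZ

/-- Column sums of the block matrix are 1 and the feedback η s cancels between states and surpluses,
so only the gradient term survives in the average. -/
theorem avg_succ_apply (l : Fin 2) (q : ℕ) (r : Fin (S.N l)) (c : Fin (S.m l)) :
    Z.avg l ((q + 1) * S.R) r c =
      Z.avg l (q * S.R) r c - stepsize a₀ q * Z.meanGrad G E l q r c := by
  obtain ⟨h1, h2⟩ := hZ.vec_period l r c q
  have hP : ∀ (P : Matrix (Fin (S.n l)) (Fin (S.n l)) ℝ) (v : Fin (S.n l) → ℝ),
      ∑ i, P.mulVec v i = ∑ j, (∑ i, P i j) * v j := fun P v => by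
    simp only [Matrix.mulVec, dotProduct, sum_mul]
    exact sum_comm
  have hB := Matrix.sum_mulVec_of_mem_colStochastic
    (prodFrom_mem (matB_mem (net := net) l r c) (q * S.R) S.R)
    (x := Z.surplusVec l r c (q * S.R))
  rw [avg_apply, avg_apply, meanGrad_apply, h1, h2]
  simp only [Pi.sub_apply, Pi.add_apply, Pi.smul_apply, smul_eq_mul, sum_sub_distrib,
    sum_add_distrib, ← mul_sum]
  rw [hB, hP, hP]
  simp only [sum_lowerFrom (A := matA net l r c) (matB_mem (net := net) l r c), sub_mul, one_mul,
    sum_sub_distrib]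
  ring

theorem avg_succ (l : Fin 2) (q : ℕ) (r : Fin (S.N l)) :
    Z.avg l ((q + 1) * S.R) r =
      Z.avg l (q * S.R) r - stepsize a₀ q • Z.meanGrad G E l q r := by
  ext c
  simpa using hZ.avg_succ_apply l q r c

/-- The surpluses also start at x₀, whence the factor 2. -/
theorem avg_zero_apply (l : Fin 2) (r : Fin (S.N l)) (c : Fin (S.m l)) :
    Z.avg l 0 r c = 2 * x₀ l r c := by
  have hn : (0 : ℝ) < S.n l := by exact_mod_cast S.n_pos l
  rw [avg_apply]
  simp only [stateVec, surplusVec, hZ.init_σ, hZ.init_s, sum_const, card_univ, Fintype.card_fin,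
    nsmul_eq_mul]
  field_simp
  norm_num

variable (hG : G.Assumptions L) (hD : IsDiscretization G pts) (hE : ∀ l, (L l l : ℝ) < E l)
include hG hD hE

theorem norm_grad_le (l : Fin 2) (i : Fin (S.n l)) (t : ℕ) (r : Fin (S.N l)) :
    ‖Z.grad G E l i t r‖ ≤ L l l + E l := by
  have hE0 : 0 ≤ E l := (NNReal.coe_nonneg _).trans (hE l).le
  have hN : (1 : ℝ) ≤ S.N l := by exact_mod_cast S.N_pos l
  have h1 : 1 / (S.N l : ℝ) ≤ 1 := (div_le_one (by positivity)).2 hN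
  have h2 := (norm_add_le (Z.w l i t r) (penaltyGrad G E l (Z.σ l i t r))).trans
    (add_le_add (norm_subgradient_expCost_le hG hD (hZ.subgradient l i t r))
      (norm_penaltyGrad_le hE0 _))
  rw [grad, norm_smul, Real.norm_of_nonneg (by positivity)]
  calc _ ≤ 1 * _ := mul_le_mul_of_nonneg_right h1 (norm_nonneg _)
    _ ≤ _ := by rwa [one_mul]

theorem norm_meanGrad_le (l : Fin 2) (q : ℕ) (r : Fin (S.N l)) :
    ‖Z.meanGrad G E l q r‖ ≤ L l l + E l := by
  have hn : (0 : ℝ) < S.n l := by exact_mod_cast S.n_pos l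
  rw [meanGrad, norm_smul, Real.norm_of_nonneg (by positivity), one_div, inv_mul_le_iff₀ hn]
  refine (norm_sum_le _ _).trans
    ((sum_le_sum fun i _ => hZ.norm_grad_le hG hD hE l i _ r).trans_eq ?_)
  rw [sum_const, card_univ, Fintype.card_fin, nsmul_eq_mul]

theorem abs_avg_succ_sub_le (ha₀ : 0 < a₀) (l : Fin 2) (q : ℕ) (r : Fin (S.N l))
    (c : Fin (S.m l)) :
    |Z.avg l ((q + 1) * S.R) r c - Z.avg l (q * S.R) r c| ≤
      (a₀ + 2) * (L l l + E l) * decay q := by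
  have h1 : |Z.meanGrad G E l q r c| ≤ L l l + E l :=
    (PiLp.norm_apply_le (Z.meanGrad G E l q r) c).trans (hZ.norm_meanGrad_le hG hD hE l q r)
  have h2 := stepsize_le ha₀ q
  have h3 := (stepsize_pos ha₀ q).le
  have h4 : 0 ≤ (a₀ + 2) * decay q := h3.trans h2
  rw [hZ.avg_succ_apply, sub_sub_cancel_left, abs_neg, abs_mul, abs_of_nonneg h3]
  calc _ ≤ (a₀ + 2) * decay q * (L l l + E l) := mul_le_mul h2 h1 (abs_nonneg _) h4
    _ = _ := by ring

end IsRun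

/-! ### Consensus of states and accuracy of the estimates -/

variable {G : Game S} {L : Fin 2 → Fin 2 → NNReal} {pts : Points S}
  {net : Network S} {E : Fin 2 → ℝ} {η a₀ : ℝ} (x₀ : ∀ l, Strat S l)

/-- The states of the agents of a subnetwork approach their average. -/
theorem exists_abs_state_sub_avg_le_entry (hG : G.Assumptions L) (hD : IsDiscretization G pts)
    (hnet : NetworkAssumptions net) (hE : ∀ l, (L l l : ℝ) < E l) (ha₀ : 0 < a₀) (l : Fin 2)
    (hη : SurplusConsensus (S.n l) (2 * S.n l) ((1 / (S.n l : ℝ)) ^ (2 * S.R * S.n l))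
      (S.n l * S.R) η) (r : Fin (S.N l)) (c : Fin (S.m l)) :
    ∃ M, 0 ≤ M ∧ ∀ Z : Trajectory S, Z.IsRun G pts net E η a₀ x₀ → ∀ q i,
      |Z.σ l i (q * S.R) r c - Z.avg l (q * S.R) r c| ≤ M * decay q := by
  have hn : (1 : ℝ) ≤ S.n l := by exact_mod_cast S.n_pos l
  have hΓ : 0 ≤ (L l l : ℝ) + E l := by
    have := NNReal.coe_nonneg (L l l)
    linarith [hE l]
  obtain ⟨M, hM0, hM⟩ := hη (S.n l * |x₀ l r c|) (2 * ((a₀ + 2) * (L l l + E l)))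
    (by positivity) (by positivity)
  refine ⟨M, hM0, fun Z hZ q i => ?_⟩
  have : Nonempty (Fin (S.n l)) := ⟨⟨0, S.n_pos l⟩⟩
  have hsm := surplusMatrices l r c hnet
  -- The deviation of the states from the average, driven by the deviation of the agents' directions
  -- from their mean; the sum condition Σy + Σs = 0 is the definition of the average.
  have hbd := hM _ _ _ hsm
    (fun q => Z.stateVec l r c (q * S.R) - Z.avg l (q * S.R) r c • (1 : Fin (S.n l) → ℝ))
    (fun q => Z.surplusVec l r c (q * S.R))
    (fun q => stepsize a₀ q • ((fun i => Z.grad G E l i (q * S.R) r c) -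
      Z.meanGrad G E l q r c • (1 : Fin (S.n l) → ℝ))) ?_ ?_ ?_ ?_ ?_ ?_ q
  · have := (norm_le_pi_norm _ i).trans hbd
    simpa [stateVec] using this
  · intro q
    rw [(hZ.vec_period l r c q).1, hZ.avg_succ_apply, Matrix.mulVec_sub, Matrix.mulVec_smul,
      Matrix.one_vecMul_of_mem_rowStochastic (hsm.rowA q)]
    funext i
    simp only [Pi.sub_apply, Pi.add_apply, Pi.smul_apply, smul_eq_mul, Pi.one_apply]
    ring
  · intro q
    rw [(hZ.vec_period l r c q).2, Matrix.mulVec_sub, Matrix.mulVec_smul, hsm.oneC, smul_zero,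
      sub_zero]
  · intro q
    simp only [Pi.sub_apply, Pi.smul_apply, Pi.one_apply, smul_eq_mul, mul_one, sum_sub_distrib,
      sum_const, card_univ, Fintype.card_fin, nsmul_eq_mul, avg_apply]
    field_simp
    ring
  · refine (pi_norm_le_iff_of_nonempty _).2 fun i => ?_
    simp only [zero_mul, Pi.sub_apply, Pi.smul_apply, Pi.one_apply, smul_eq_mul, mul_one,
      hZ.avg_zero_apply, stateVec, hZ.init_σ, Real.norm_eq_abs]
    rw [show x₀ l r c - 2 * x₀ l r c = -x₀ l r c by ring, abs_neg]
    exact le_mul_of_one_le_left (abs_nonneg _) hn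
  · simp [surplusVec, hZ.init_s]
  · intro q
    have h3 := (stepsize_pos ha₀ q).le
    rw [norm_smul, Real.norm_of_nonneg h3]
    have h4 : ‖(fun i => Z.grad G E l i (q * S.R) r c) -
        Z.meanGrad G E l q r c • (1 : Fin (S.n l) → ℝ)‖ ≤ 2 * (L l l + E l) := by
      refine (pi_norm_le_iff_of_nonempty _).2 fun i => ?_
      have g1 := (PiLp.norm_apply_le _ c).trans (hZ.norm_grad_le hG hD hE l i (q * S.R) r)
      have g2 := (PiLp.norm_apply_le _ c).trans (hZ.norm_meanGrad_le hG hD hE l q r)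
      have g3 := norm_sub_le (Z.grad G E l i (q * S.R) r c) (Z.meanGrad G E l q r c)
      simp only [Pi.sub_apply, Pi.smul_apply, Pi.one_apply, smul_eq_mul, mul_one]
      linarith
    calc _ ≤ (a₀ + 2) * decay q * (2 * (L l l + E l)) :=
          mul_le_mul (stepsize_le ha₀ q) h4 (norm_nonneg _) (h3.trans (stepsize_le ha₀ q))
      _ = _ := by ring

/-- The surplus parameter `η` yields consensus in both subnetworks. -/
def IsConsensusParam (S : Sizes) (η : ℝ) : Prop :=
  ∀ l, SurplusConsensus (S.n l) (2 * S.n l) ((1 / (S.n l : ℝ)) ^ (2 * S.R * S.n l))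
    (S.n l * S.R) η

theorem exists_isConsensusParam (S : Sizes) :
    ∃ ηbar : ℝ, 0 < ηbar ∧ ∀ η, 0 < η → η < ηbar → IsConsensusParam S η := by
  have key : ∀ l : Fin 2, ∃ ηbar : ℝ, 0 < ηbar ∧ ∀ η, 0 < η → η < ηbar →
      SurplusConsensus (S.n l) (2 * S.n l) ((1 / (S.n l : ℝ)) ^ (2 * S.R * S.n l))
        (S.n l * S.R) η := fun l => by
    have hn : (1 : ℝ) ≤ S.n l := by exact_mod_cast S.n_pos l
    refine exists_surplusConsensus (S.n_pos l) (by have := S.n_pos l; omega) (by positivity)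
      (pow_le_one₀ (by positivity) ((div_le_one (by positivity)).2 hn)) (by positivity)
  choose f hf0 hf using key
  refine ⟨min (f 0) (f 1), lt_min (hf0 0) (hf0 1), fun η hη hlt l => hf l η hη ?_⟩
  fin_cases l
  · exact hlt.trans_le (min_le_left _ _)
  · exact hlt.trans_le (min_le_right _ _)

theorem exists_abs_state_sub_avg_le (hG : G.Assumptions L) (hD : IsDiscretization G pts)
    (hnet : NetworkAssumptions net) (hE : ∀ l, (L l l : ℝ) < E l) (ha₀ : 0 < a₀)
    (hη : IsConsensusParam S η) :
    ∃ M, 0 ≤ M ∧ ∀ Z : Trajectory S, Z.IsRun G pts net E η a₀ x₀ → ∀ l r c q i,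
      |Z.σ l i (q * S.R) r c - Z.avg l (q * S.R) r c| ≤ M * decay q := by
  choose M hM0 hM using fun p : (l : Fin 2) × Fin (S.N l) × Fin (S.m l) =>
    exists_abs_state_sub_avg_le_entry x₀ hG hD hnet hE ha₀ p.1 (hη p.1) p.2.1 p.2.2
  refine ⟨∑ p, M p, sum_nonneg fun p _ => hM0 p, fun Z hZ l r c q i => ?_⟩
  exact (hM ⟨l, r, c⟩ Z hZ q i).trans (mul_le_mul_of_nonneg_right
    (single_le_sum (f := M) (fun p _ => hM0 p) (mem_univ _)) (decay_pos q).le)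

namespace IsRun

variable {x₀} {Z : Trajectory S} (hZ : Z.IsRun G pts net E η a₀ x₀) {M : ℝ}
include hZ

/-- At any time, also inside a period, the compressed estimate is a row-stochastic image of the
states at the start of the period, so it is no farther from their average. -/
theorem abs_est_sub_avg_le
    (hM : ∀ l r c q i, |Z.σ l i (q * S.R) r c - Z.avg l (q * S.R) r c| ≤ M * decay q) (l : Fin 2)
    (i : Fin (S.n l)) (r : Fin (S.N l)) (c : Fin (S.m l)) (t : ℕ) :
    |Z.est net l i t r c - Z.avg l (t / S.R * S.R) r c| ≤ M * decay (t / S.R) := by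
  have : Nonempty (Fin (S.n l)) := ⟨⟨0, S.n_pos l⟩⟩
  obtain ⟨q, hq⟩ : ∃ q, q = t / S.R := ⟨_, rfl⟩
  rw [← hq]
  have hw := (hZ.vec_within l r c q (Nat.mod_lt t S.R_pos)).1
  rw [hq, Nat.div_add_mod', ← hq] at hw
  set P := matA net l r c t * prodFrom (matA net l r c) (q * S.R) (t % S.R) with hP
  have hPm : P ∈ Matrix.rowStochastic ℝ (Fin (S.n l)) :=
    mul_mem (matA_mem l r c t) (prodFrom_mem (matA_mem l r c) _ _)
  have h1 : Z.est net l i t r c = P.mulVec (Z.stateVec l r c (q * S.R)) i := by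
    rw [hP, ← Matrix.mulVec_mulVec, ← hw]; rfl
  have h2 : P.mulVec (Z.stateVec l r c (q * S.R) - Z.avg l (q * S.R) r c • 1) =
      P.mulVec (Z.stateVec l r c (q * S.R)) - Z.avg l (q * S.R) r c • 1 := by
    rw [Matrix.mulVec_sub, Matrix.mulVec_smul, Matrix.one_vecMul_of_mem_rowStochastic hPm]
  have h3 : ‖Z.stateVec l r c (q * S.R) - Z.avg l (q * S.R) r c • (1 : Fin (S.n l) → ℝ)‖ ≤
      M * decay q := (pi_norm_le_iff_of_nonempty _).2 fun i => by
    simpa [stateVec] using hM l r c q i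
  have h4 := (norm_le_pi_norm _ i).trans ((norm_mulVec_le hPm _).trans h3)
  rw [h2] at h4
  simpa [h1] using h4

/-- An estimate of the rival's strategy is close to the rival's average at the last reception. -/
theorem exists_last_reception
    (hM : ∀ l r c q i, |Z.σ l i (q * S.R) r c - Z.avg l (q * S.R) r c| ≤ M * decay q) {l j : Fin 2}
    (hj : j ≠ l) (i : Fin (S.n l)) (r : Fin (S.N j)) (c : Fin (S.m j)) (t : ℕ) :
    ∃ τ ≤ t, |Z.ζ l i t j r c - Z.avg j (τ / S.R * S.R) r c| ≤ M * decay (τ / S.R) ∧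
      ∀ τ', τ < τ' → τ' ≤ t → (crossNbrs net l i j r c τ').card = 0 := by
  induction t with
  | zero =>
    -- Time 0 counts as a reception, since the initial estimate equals the rival's common initial
    -- state.
    refine ⟨0, le_rfl, ?_, fun τ' h1 h2 => by omega⟩
    have := hM j r c 0 ⟨0, S.n_pos j⟩
    rw [zero_mul, hZ.init_σ] at this
    rwa [Nat.zero_div, zero_mul, hZ.init_ζ l i j hj]
  | succ t ih =>
    rw [hZ.estimate l i j hj t r c]
    split_ifs with h
    · refine ⟨t + 1, le_rfl, ?_, fun τ' h1 h2 => by omega⟩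
      set s := crossNbrs net l i j r c (t + 1) with hs
      have hs0 : (0 : ℝ) < s.card := by exact_mod_cast Nat.pos_of_ne_zero h
      set A := Z.avg j ((t + 1) / S.R * S.R) r c with hA
      have e : ∑ i' ∈ s, 1 / (s.card : ℝ) * Z.est net j i' (t + 1) r c - A =
          (1 / (s.card : ℝ)) * ∑ i' ∈ s, (Z.est net j i' (t + 1) r c - A) := by
        rw [sum_sub_distrib, sum_const, nsmul_eq_mul, ← mul_sum]
        field_simp
      rw [e, abs_mul, abs_of_pos (by positivity), one_div, inv_mul_le_iff₀ hs0]
      refine (abs_sum_le_sum_abs _ _).trans ((sum_le_sum fun i' _ =>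
        hZ.abs_est_sub_avg_le hM j i' r c (t + 1)).trans_eq ?_)
      simp
    · obtain ⟨τ, h1, h2, h3⟩ := ih
      refine ⟨τ, by omega, h2, fun τ' k1 k2 => ?_⟩
      rcases Nat.lt_or_ge t τ' with k | k
      · obtain rfl : τ' = t + 1 := by omega
        simpa using h
      · exact h3 τ' k1 k

theorem abs_rival_sub_avg_le (hG : G.Assumptions L) (hD : IsDiscretization G pts)
    (hnet : NetworkAssumptions net) (hE : ∀ l, (L l l : ℝ) < E l) (ha₀ : 0 < a₀) (hM0 : 0 ≤ M)
    (hM : ∀ l r c q i, |Z.σ l i (q * S.R) r c - Z.avg l (q * S.R) r c| ≤ M * decay q) {l j : Fin 2}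
    (hj : j ≠ l) (i : Fin (S.n l)) (r : Fin (S.N j)) (c : Fin (S.m j)) (q : ℕ) :
    |Z.ζ l i (q * S.R) j r c - Z.avg j (q * S.R) r c| ≤
      2 * (M + 2 * ((a₀ + 2) * (L j j + E j))) * decay q := by
  have hR := S.R_pos
  obtain ⟨τ, h1, h2, h3⟩ := hZ.exists_last_reception hM hj i r c (q * S.R)
  obtain ⟨p, hp⟩ : ∃ p, p = τ / S.R := ⟨_, rfl⟩
  rw [← hp] at h2
  have hpq : p ≤ q := by
    rw [hp]
    exact (Nat.div_le_div_right h1).trans_eq (Nat.mul_div_cancel _ hR)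
  have hqp : q ≤ p + 2 := by
    by_contra! hlt
    have hq2 : (p + 3) * S.R ≤ q * S.R := Nat.mul_le_mul_right _ hlt
    have e3 : (p + 3) * S.R = (p + 1) * S.R + 2 * S.R := by ring
    -- If q ≥ p + 3, the 2 R steps ending at q R all come after τ and contain a reception, contrary
    -- to the choice of τ.
    obtain ⟨τ', k1, k2, k3⟩ := exists_crossNbrs l hnet hj i r c (q * S.R + 1 - 2 * S.R)
    have hlt' : τ < (p + 1) * S.R := by
      rw [hp, Nat.succ_mul]; exact Nat.lt_div_mul_add hR
    exact k3 (h3 τ' (by omega) (by omega))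
  set Γ := (a₀ + 2) * (L j j + E j) with hΓ
  have hΓ0 : 0 ≤ Γ := by
    have := NNReal.coe_nonneg (L j j)
    exact mul_nonneg (by linarith) (by linarith [hE j])
  have hdrift : ∀ k, |Z.avg j ((p + k) * S.R) r c - Z.avg j (p * S.R) r c| ≤
      k * (Γ * decay p) := by
    intro k
    induction k with
    | zero => simp
    | succ k ih =>
      have h := hZ.abs_avg_succ_sub_le hG hD hE ha₀ j (p + k) r c
      have h' : Γ * decay (p + k) ≤ Γ * decay p :=
        mul_le_mul_of_nonneg_left (decay_antitone (Nat.le_add_right _ _)) hΓ0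
      refine (abs_sub_le _ (Z.avg j ((p + k) * S.R) r c) _).trans ?_
      rw [← add_assoc]
      push_cast
      linarith
  obtain ⟨k, rfl⟩ := Nat.exists_eq_add_of_le hpq
  have hk : (k : ℝ) ≤ 2 := by exact_mod_cast (by omega : k ≤ 2)
  have h5 : decay p ≤ 2 * decay (p + k) := by
    refine decay_le_mul_decay zero_le_two ?_
    push_cast
    nlinarith [Nat.cast_nonneg (α := ℝ) p]
  have h6 := hdrift k
  have h7 : (k : ℝ) * (Γ * decay p) ≤ 2 * (Γ * decay p) :=
    mul_le_mul_of_nonneg_right hk (mul_nonneg hΓ0 (decay_pos p).le)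
  have h8 := abs_sub_le (Z.ζ l i ((p + k) * S.R) j r c) (Z.avg j (p * S.R) r c)
    (Z.avg j ((p + k) * S.R) r c)
  rw [abs_sub_comm (Z.avg j (p * S.R) r c)] at h8
  have h9 : (M + 2 * Γ) * decay p ≤ (M + 2 * Γ) * (2 * decay (p + k)) :=
    mul_le_mul_of_nonneg_left h5 (by positivity)
  linarith

end IsRun

end Trajectory

/-! ### Descent towards equilibrium and the rate of the gaps -/

namespace Trajectory

variable {G : Game S} {L : Fin 2 → Fin 2 → NNReal} {pts : Points S}
  {net : Network S} {E : Fin 2 → ℝ} {η a₀ : ℝ} (x₀ : ∀ l, Strat S l)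

/-- What an agent sees is close to the profile of average states. -/
theorem exists_norm_view_sub_avg_le (hG : G.Assumptions L) (hD : IsDiscretization G pts)
    (hnet : NetworkAssumptions net) (hE : ∀ l, (L l l : ℝ) < E l) (ha₀ : 0 < a₀)
    (hη : IsConsensusParam S η) :
    ∃ M, 0 ≤ M ∧ ∀ Z : Trajectory S, Z.IsRun G pts net E η a₀ x₀ → ∀ l i q j r,
      ‖Z.view l i (q * S.R) j r - Z.avg j (q * S.R) r‖ ≤ M * decay q := by
  obtain ⟨M, hM0, hM⟩ := exists_abs_state_sub_avg_le x₀ hG hD hnet hE ha₀ hη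
  have hΓ : ∀ j, 0 ≤ (a₀ + 2) * (L j j + E j) := fun j => by
    have := NNReal.coe_nonneg (L j j)
    exact mul_nonneg (by linarith) (by linarith [hE j])
  set B : Fin 2 → ℝ := fun j => 2 * (M + 2 * ((a₀ + 2) * (L j j + E j))) with hB
  have hBM : ∀ j, M ≤ B j := fun j => by simp only [hB]; linarith [hΓ j]
  have hB0 : ∀ j, 0 ≤ B j := fun j => hM0.trans (hBM j)
  refine ⟨∑ j, S.m j * B j, sum_nonneg fun j _ => mul_nonneg (by positivity) (hB0 j),
    fun Z hZ l i q j r => ?_⟩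
  have hle : (S.m j : ℝ) * (B j * decay q) ≤ (∑ j, S.m j * B j) * decay q := by
    rw [← mul_assoc]
    exact mul_le_mul_of_nonneg_right (single_le_sum (f := fun j => (S.m j : ℝ) * B j)
      (fun j _ => mul_nonneg (by positivity) (hB0 j)) (mem_univ j)) (decay_pos q).le
  refine (norm_le_mul_of_forall_abs_le _ (mul_nonneg (hB0 j) (decay_pos q).le)
    fun c => ?_).trans hle
  by_cases hj : j = l
  · subst hj
    simpa [view] using (hM Z hZ j r c q i).trans
      (mul_le_mul_of_nonneg_right (hBM j) (decay_pos q).le)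
  · simpa [view, Function.update_of_ne hj] using
      hZ.abs_rival_sub_avg_le hG hD hnet hE ha₀ hM0 (hM Z hZ) hj i r c q

/-- Profile of the average states at the start of period `q`. -/
def avgProfile (Z : Trajectory S) (q : ℕ) : ∀ j, Strat S j := fun j => Z.avg j (q * S.R)

variable {x₀} {Z : Trajectory S}

/-- The mean over agents and types of `sub_le_inner_direction`, all agents being compared with the
same profile of averages. The factor 1/N in the update direction is the probability of each type. -/
theorem IsRun.sub_le_inner_meanGrad (hZ : Z.IsRun G pts net E η a₀ x₀) (hG : G.Assumptions L)
    (hD : IsDiscretization G pts) (hE : ∀ l, (L l l : ℝ) < E l) {ε : ℝ} {l : Fin 2} {q : ℕ}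
    (hview : ∀ i j r, ‖Z.view l i (q * S.R) j r - Z.avg j (q * S.R) r‖ ≤ ε)
    {σl : Strat S l} (hσ : ∀ r, σl r ∈ G.X l) :
    totalCost G pts (G.cost l) (Z.avgProfile q) -
        totalCost G pts (G.cost l) (Function.update (Z.avgProfile q) l σl) +
        meanPenalty G E l (Z.avg l (q * S.R)) ≤
      ∑ r, inner ℝ (Z.meanGrad G E l q r) (Z.avg l (q * S.R) r - σl r) +
        2 * (L l l + L l (l + 1) + E l) * ε := by
  have hE0 : 0 ≤ E l := (NNReal.coe_nonneg _).trans (hE l).le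
  have hn : (0 : ℝ) < S.n l := by exact_mod_cast S.n_pos l
  have hN : (0 : ℝ) < S.N l := by exact_mod_cast S.N_pos l
  set K := 2 * (L l l + L l (l + 1) + E l) * ε with hK
  have key : ∀ r, expCost G pts (G.cost l) l r (Z.avgProfile q) -
      expCost G pts (G.cost l) l r (Function.update (Z.avgProfile q) l σl) +
      penalty G E l (Z.avg l (q * S.R) r) ≤
      S.N l * inner ℝ (Z.meanGrad G E l q r) (Z.avg l (q * S.R) r - σl r) + K := by
    intro r
    have h1 : ∀ i ∈ univ, expCost G pts (G.f l i) l r (Z.avgProfile q) -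
        expCost G pts (G.f l i) l r (Function.update (Z.avgProfile q) l σl) +
        penalty G E l (Z.avg l (q * S.R) r) ≤
        S.N l * inner ℝ (Z.grad G E l i (q * S.R) r) (Z.avg l (q * S.R) r - σl r) + K := by
      intro i _
      have hv : Z.view l i (q * S.R) l r = Z.σ l i (q * S.R) r := by simp [view]
      have hw := hZ.subgradient l i (q * S.R) r
      rw [← hv] at hw
      have := sub_le_inner_direction (E := E) (x := Z.avgProfile q) hG hD hE0 hw rfl (hσ r)
        (hview i l r) (fun r' => hview i (l + 1) r')
      rw [grad, inner_smul_left, ← hv]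
      refine this.trans_eq ?_
      simp only [avgProfile, conj_trivial, hK]
      field_simp
    have h2 := sum_le_sum h1
    simp only [sum_add_distrib, sum_sub_distrib, sum_const, card_univ, Fintype.card_fin,
      nsmul_eq_mul, ← mul_sum, ← sum_inner] at h2
    rw [expCost_cost, expCost_cost, meanGrad, inner_smul_left, conj_trivial]
    have h3 := mul_le_mul_of_nonneg_left h2 (by positivity : 0 ≤ 1 / (S.n l : ℝ))
    calc _ = 1 / (S.n l : ℝ) * (∑ i, expCost G pts (G.f l i) l r (Z.avgProfile q) -
          ∑ i, expCost G pts (G.f l i) l r (Function.update (Z.avgProfile q) l σl) +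
          S.n l * penalty G E l (Z.avg l (q * S.R) r)) := by field_simp
      _ ≤ _ := h3
      _ = _ := by field_simp
  have h4 := sum_le_sum fun r (_ : r ∈ univ) => key r
  simp only [sum_add_distrib, sum_sub_distrib, sum_const, card_univ, Fintype.card_fin,
    nsmul_eq_mul, ← mul_sum] at h4
  have h5 := mul_le_mul_of_nonneg_left h4 (by positivity : 0 ≤ 1 / (S.N l : ℝ))
  rw [← mean_expCost hD _ l, ← mean_expCost hD _ l, meanPenalty, ← mul_sub, ← mul_add]
  refine h5.trans_eq ?_
  field_simp

/-- By the zero-sum property the equilibrium values cancel, the terms at x add up to zero, and the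
cost of one side at a mixed profile is minus that of the other. So gaps against the unknown
equilibrium become differences at the current profile, which subgradients control. -/
theorem sum_gap_eq (hG : G.Assumptions L) (hD : IsDiscretization G pts)
    (σstar x : ∀ j, Strat S j) :
    ∑ l, gap G pts E σstar l (x l) = ∑ l, (totalCost G pts (G.cost l) x -
      totalCost G pts (G.cost l) (Function.update x l (σstar l)) + meanPenalty G E l (x l)) := by
  have e0 : Function.update x 0 (σstar 0) = Function.update σstar 1 (x 1) := by
    funext j; fin_cases j <;> simp
  have e1 : Function.update x 1 (σstar 1) = Function.update σstar 0 (x 0) := by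
    funext j; fin_cases j <;> simp
  simp only [Fin.sum_univ_two, gap, e0, e1]
  have h1 := totalCost_add hG hD x
  have h2 := totalCost_add hG hD σstar
  have h3 := totalCost_add hG hD (Function.update σstar 1 (x 1))
  have h4 := totalCost_add hG hD (Function.update σstar 0 (x 0))
  linarith

/-- Squared distance of the average states to a profile. -/
def sqDist (Z : Trajectory S) (σstar : ∀ l, Strat S l) (q : ℕ) (l : Fin 2) : ℝ :=
  ∑ r, ‖Z.avg l (q * S.R) r - σstar l r‖ ^ 2

theorem IsRun.sqDist_succ_le (hZ : Z.IsRun G pts net E η a₀ x₀) (hG : G.Assumptions L)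
    (hD : IsDiscretization G pts) (hE : ∀ l, (L l l : ℝ) < E l) (ha₀ : 0 < a₀)
    (σstar : ∀ l, Strat S l) (q : ℕ) (l : Fin 2) :
    Z.sqDist σstar (q + 1) l ≤ Z.sqDist σstar q l - 2 * (stepsize a₀ q *
      ∑ r, inner ℝ (Z.meanGrad G E l q r) (Z.avg l (q * S.R) r - σstar l r)) +
      S.N l * ((a₀ + 2) * (L l l + E l)) ^ 2 * decay q ^ 2 := by
  have hα := (stepsize_pos ha₀ q).le
  have h1 : ∀ r ∈ univ, ‖Z.avg l ((q + 1) * S.R) r - σstar l r‖ ^ 2 ≤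
      ‖Z.avg l (q * S.R) r - σstar l r‖ ^ 2 - 2 * (stepsize a₀ q *
        inner ℝ (Z.meanGrad G E l q r) (Z.avg l (q * S.R) r - σstar l r)) +
      ((a₀ + 2) * (L l l + E l)) ^ 2 * decay q ^ 2 := by
    intro r _
    rw [hZ.avg_succ, sub_right_comm, norm_sub_sq_real, inner_smul_right, real_inner_comm]
    refine add_le_add_right ?_ _
    rw [← mul_pow]
    refine pow_le_pow_left₀ (norm_nonneg _) ?_ 2
    rw [norm_smul, Real.norm_of_nonneg hα]
    calc _ ≤ (a₀ + 2) * decay q * (L l l + E l) :=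
          mul_le_mul (stepsize_le ha₀ q) (hZ.norm_meanGrad_le hG hD hE l q r) (norm_nonneg _)
            (hα.trans (stepsize_le ha₀ q))
      _ = _ := by ring
  refine (sum_le_sum h1).trans_eq ?_
  simp only [sum_add_distrib, sum_sub_distrib, sum_const, card_univ, Fintype.card_fin,
    nsmul_eq_mul, ← mul_sum, sqDist]
  ring

theorem exists_sum_stepsize_mul_gap_le (hG : G.Assumptions L) (hD : IsDiscretization G pts)
    (hnet : NetworkAssumptions net) (hE : ∀ l, (L l l : ℝ) < E l) (ha₀ : 0 < a₀)
    (hη : IsConsensusParam S η) (x₀ : ∀ l, Strat S l) :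
    ∃ C, 0 ≤ C ∧ ∀ (σstar : ∀ l, Strat S l) (Z : Trajectory S), IsDBNE G pts σstar →
      Z.IsRun G pts net E η a₀ x₀ → ∀ n, ∑ q ∈ range n, stepsize a₀ q *
        ∑ l, gap G pts E σstar l (Z.avg l (q * S.R)) ≤ C * (1 + ∑ q ∈ range n, decay q ^ 2) := by
  obtain ⟨M, hM0, hM⟩ := exists_norm_view_sub_avg_le x₀ hG hD hnet hE ha₀ hη
  have hE0 : ∀ l, 0 ≤ E l := fun l => (NNReal.coe_nonneg _).trans (hE l).le
  have hbdd : ∀ l, ∃ B, ∀ x ∈ G.X l, ‖x‖ ≤ B := fun l => (hG.compact l).isBounded.exists_norm_le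
  choose B hB using hbdd
  -- Bounds the initial squared distance to every equilibrium at once, by boundedness of the action
  -- sets. `W` collects the squared steps and the step times the view error, both of order `decay q
  -- ^ 2`.
  obtain ⟨D₀, hD₀⟩ : ∃ D₀, D₀ = ∑ l, ∑ r, (2 * ‖x₀ l r‖ + B l) ^ 2 := ⟨_, rfl⟩
  have hD₀0 : 0 ≤ D₀ := by rw [hD₀]; positivity
  obtain ⟨W, hW⟩ : ∃ W : Fin 2 → ℝ, W = fun l => S.N l * ((a₀ + 2) * (L l l + E l)) ^ 2 +
    4 * ((a₀ + 2) * (L l l + L l (l + 1) + E l) * M) := ⟨_, rfl⟩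
  have hW0 : ∀ l, 0 ≤ W l := fun l => by
    have := hE0 l
    rw [hW]; positivity
  refine ⟨D₀ + ∑ l, W l, add_nonneg hD₀0 (sum_nonneg fun l _ => hW0 l),
    fun σstar Z hσ hZ n => ?_⟩
  have hstep : ∀ q, 2 * (stepsize a₀ q * ∑ l, gap G pts E σstar l (Z.avg l (q * S.R))) ≤
      ∑ l, Z.sqDist σstar q l - ∑ l, Z.sqDist σstar (q + 1) l + (∑ l, W l) * decay q ^ 2 := by
    intro q
    have hα := (stepsize_pos ha₀ q).le
    have h1 : ∀ l ∈ univ, 2 * (stepsize a₀ q * (totalCost G pts (G.cost l) (Z.avgProfile q) -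
        totalCost G pts (G.cost l) (Function.update (Z.avgProfile q) l (σstar l)) +
        meanPenalty G E l (Z.avg l (q * S.R)))) ≤
        Z.sqDist σstar q l - Z.sqDist σstar (q + 1) l + W l * decay q ^ 2 := by
      intro l _
      have h2 := hZ.sub_le_inner_meanGrad hG hD hE (fun i j r => hM Z hZ l i q j r)
        (fun r => (hσ l r).1)
      have h3 := mul_le_mul_of_nonneg_left h2 hα
      have h4 := hZ.sqDist_succ_le hG hD hE ha₀ σstar q l
      have h5 : stepsize a₀ q * (2 * (L l l + L l (l + 1) + E l) * (M * decay q)) ≤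
          (a₀ + 2) * decay q * (2 * (L l l + L l (l + 1) + E l) * (M * decay q)) := by
        refine mul_le_mul_of_nonneg_right (stepsize_le ha₀ q) ?_
        have := hE0 l
        have := decay_pos q
        positivity
      rw [hW]
      linarith
    have h6 := sum_le_sum h1
    simp only [sum_add_distrib, sum_sub_distrib, ← mul_sum, ← sum_mul] at h6
    have h7 := sum_gap_eq (E := E) hG hD σstar (Z.avgProfile q)
    simp only [sum_add_distrib, sum_sub_distrib, avgProfile] at h6 h7
    rw [h7]
    exact h6
  have htel : ∀ n, ∑ q ∈ range n, 2 * (stepsize a₀ q *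
      ∑ l, gap G pts E σstar l (Z.avg l (q * S.R))) ≤
      ∑ l, Z.sqDist σstar 0 l - ∑ l, Z.sqDist σstar n l +
        (∑ l, W l) * ∑ q ∈ range n, decay q ^ 2 := by
    intro n
    induction n with
    | zero => simp
    | succ n ih => rw [sum_range_succ, sum_range_succ, mul_add]; linarith [hstep n]
  have hinit : ∑ l, Z.sqDist σstar 0 l ≤ D₀ := by
    rw [hD₀]
    refine sum_le_sum fun l _ => sum_le_sum fun r _ => pow_le_pow_left₀ (norm_nonneg _) ?_ 2
    have : Z.avg l (0 * S.R) r = (2 : ℝ) • x₀ l r := by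
      ext c; rw [zero_mul, hZ.avg_zero_apply]; simp
    rw [this]
    refine (norm_sub_le _ _).trans (add_le_add ?_ (hB l _ (hσ l r).1))
    rw [norm_smul]; simp
  have hnn : 0 ≤ ∑ l, Z.sqDist σstar n l :=
    sum_nonneg fun l _ => sum_nonneg fun r _ => by positivity
  have h8 := htel n
  rw [← mul_sum] at h8
  have hdec : 0 ≤ ∑ q ∈ range n, decay q ^ 2 := sum_nonneg fun q _ => sq_nonneg _
  have hWs : 0 ≤ ∑ l, W l := sum_nonneg fun l _ => hW0 l
  have := mul_nonneg hD₀0 hdec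
  have := mul_nonneg hWs hdec
  linarith

theorem sum_decay_sq_le (n : ℕ) : ∑ q ∈ range n, decay q ^ 2 ≤ 1 + Real.log n := by
  refine le_trans (le_of_eq ?_) (harmonic_le_one_add_log n)
  rw [harmonic]
  push_cast
  refine sum_congr rfl fun q _ => ?_
  rw [decay, div_pow, Real.sq_sqrt (by positivity), one_pow, one_div]

theorem exists_gap_le (hG : G.Assumptions L) (hD : IsDiscretization G pts)
    (hnet : NetworkAssumptions net) (hE : ∀ l, (L l l : ℝ) < E l) (ha₀ : 0 < a₀)
    (hη : IsConsensusParam S η) (x₀ : ∀ l, Strat S l) :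
    ∃ C, 0 ≤ C ∧ ∀ (σstar : ∀ l, Strat S l) (Z : Trajectory S), IsDBNE G pts σstar →
      Z.IsRun G pts net E η a₀ x₀ → ∀ T : ℕ, 2 ≤ T → S.R ≤ T → ∀ l,
        ∃ q ∈ Set.Icc 1 (T / S.R), gap G pts E σstar l (Z.avg l (q * S.R)) ≤
          C * (Real.log T / √T) := by
  obtain ⟨C, hC0, hC⟩ := exists_sum_stepsize_mul_gap_le hG hD hnet hE ha₀ hη x₀
  have hR := S.R_pos
  have hlog2 : 0 < Real.log 2 := Real.log_pos one_lt_two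
  -- From 1 + (1 + log (K + 1)) ≤ (2 / log 2 + 2) log T, where T ≥ 2, and from T ≤ 2 R K, where K =
  -- ⌊T / R⌋ ≥ 1.
  refine ⟨C * (2 / Real.log 2 + 2) * √(2 * S.R), by positivity, fun σstar Z hσ hZ T hT hRT l => ?_⟩
  set K := T / S.R with hK
  have hK1 : 1 ≤ K := (Nat.one_le_div_iff hR).2 hRT
  have hgap : ∀ l q, 0 ≤ gap G pts E σstar l (Z.avg l (q * S.R)) :=
    fun l q => gap_nonneg hG hD hE hσ l _
  obtain ⟨q₀, hq₀, hmin⟩ := exists_min_image (Icc 1 K)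
    (fun q => gap G pts E σstar l (Z.avg l (q * S.R))) ⟨1, mem_Icc.2 ⟨le_rfl, hK1⟩⟩
  refine ⟨q₀, mem_Icc.1 hq₀, ?_⟩
  set m := gap G pts E σstar l (Z.avg l (q₀ * S.R)) with hm
  have hK0 : (0 : ℝ) < K := by exact_mod_cast hK1
  -- K weights of size at least 1/√K. Since both gaps are nonnegative, their sum dominates the gap
  -- of `l`, and the term q = 0 can be added.
  have hlow : m * √K ≤ ∑ q ∈ range (K + 1), stepsize a₀ q *
      ∑ l, gap G pts E σstar l (Z.avg l (q * S.R)) := by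
    calc m * √K = ∑ _q ∈ Icc 1 K, 1 / √K * m := by
          rw [sum_const, Nat.card_Icc, Nat.add_sub_cancel, nsmul_eq_mul]
          nth_rewrite 2 [← Real.mul_self_sqrt hK0.le]
          field_simp
      _ ≤ ∑ q ∈ Icc 1 K, stepsize a₀ q * ∑ l, gap G pts E σstar l (Z.avg l (q * S.R)) := by
          refine sum_le_sum fun q hq => mul_le_mul ?_ ?_ (hgap _ _) (stepsize_pos ha₀ q).le
          · obtain ⟨h1, h2⟩ := mem_Icc.1 hq
            have h1' : (0 : ℝ) < q := by exact_mod_cast h1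
            rw [stepsize, if_neg (by omega)]
            exact one_div_le_one_div_of_le (by positivity)
              (Real.sqrt_le_sqrt (by exact_mod_cast h2))
          · exact (hmin q hq).trans (single_le_sum
              (f := fun l => gap G pts E σstar l (Z.avg l (q * S.R)))
              (fun l _ => hgap l q) (mem_univ l))
      _ ≤ _ := by
          refine sum_le_sum_of_subset_of_nonneg (fun q hq => ?_) fun q _ _ =>
            mul_nonneg (stepsize_pos ha₀ q).le (sum_nonneg fun l _ => hgap l q)
          have := (mem_Icc.1 hq).2
          exact mem_range.2 (by omega)
  have hup := hC σstar Z hσ hZ (K + 1)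
  have hT' : (2 : ℝ) ≤ T := by exact_mod_cast hT
  have hKT : K ≤ T := Nat.div_le_self _ _
  have hlogT : Real.log 2 ≤ Real.log T := Real.log_le_log two_pos hT'
  have hlogK : Real.log ((K + 1 : ℕ) : ℝ) ≤ 2 * Real.log T := by
    rw [← Real.log_rpow (by linarith), Real.rpow_two]
    refine Real.log_le_log (by positivity) ?_
    have : (K : ℝ) ≤ T := by exact_mod_cast hKT
    push_cast
    nlinarith
  have hsum : 1 + ∑ q ∈ range (K + 1), decay q ^ 2 ≤ (2 / Real.log 2 + 2) * Real.log T := by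
    have h1 := sum_decay_sq_le (K + 1)
    have h2 : 2 ≤ 2 / Real.log 2 * Real.log T := by
      rw [div_mul_eq_mul_div, le_div_iff₀ hlog2]; linarith
    linarith
  have hsqrt : √(T : ℝ) ≤ √(2 * S.R) * √K := by
    rw [← Real.sqrt_mul (by positivity)]
    refine Real.sqrt_le_sqrt ?_
    have h1 : T < K * S.R + S.R := Nat.lt_div_mul_add hR
    have h2 : S.R ≤ K * S.R := Nat.le_mul_of_pos_left _ hK1
    have h3 : T ≤ 2 * S.R * K := by nlinarith
    exact_mod_cast h3
  have hTs : 0 < √(T : ℝ) := Real.sqrt_pos.2 (by linarith)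
  rw [mul_div_assoc', le_div_iff₀ hTs]
  calc m * √(T : ℝ) ≤ m * (√(2 * S.R) * √K) := mul_le_mul_of_nonneg_left hsqrt (hgap _ _)
    _ = √(2 * S.R) * (m * √K) := by ring
    _ ≤ √(2 * S.R) * (C * ((2 / Real.log 2 + 2) * Real.log T)) :=
        mul_le_mul_of_nonneg_left
          (hlow.trans (hup.trans (mul_le_mul_of_nonneg_left hsum hC0))) (Real.sqrt_nonneg _)
    _ = _ := by ring

theorem payoff_add_penalty_sub (hD : IsDiscretization G pts) (σstar : ∀ l, Strat S l)
    (x : Strat S 0) :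
    payoff G pts (Function.update σstar 0 x) + meanPenalty G E 0 x - payoff G pts σstar =
      gap G pts E σstar 0 x := by
  rw [payoff_eq hD, payoff_eq hD, gap]

theorem payoff_sub_payoff_sub_penalty (hG : G.Assumptions L) (hD : IsDiscretization G pts)
    (σstar : ∀ l, Strat S l) (x : Strat S 1) :
    payoff G pts σstar - (payoff G pts (Function.update σstar 1 x) - meanPenalty G E 1 x) =
      gap G pts E σstar 1 x := by
  have h1 := totalCost_add hG hD σstar
  have h2 := totalCost_add hG hD (Function.update σstar 1 x)
  rw [payoff_eq hD, payoff_eq hD, gap]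
  linarith

end Trajectory

end BayesGame

end

theorem theorem2 (S : BayesGame.Sizes) :
    ∃ ηbar : ℝ, 0 < ηbar ∧
      ∀ (G : BayesGame.Game S) (L : Fin 2 → Fin 2 → NNReal) (pts : BayesGame.Points S)
        (net : BayesGame.Network S) (E : Fin 2 → ℝ) (η a₀ : ℝ) (x₀ : ∀ l, BayesGame.Strat S l),
        G.Assumptions L →
        BayesGame.IsDiscretization G pts →
        BayesGame.NetworkAssumptions net →
        (∀ l, (L l l : ℝ) < E l) →
        0 < η → η < ηbar → 0 < a₀ →
        (∀ l r, x₀ l r ∈ G.X l) →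
        ∃ C : ℝ, ∀ (σstar : ∀ l, BayesGame.Strat S l) (Z : BayesGame.Trajectory S),
          BayesGame.IsDBNE G pts σstar →
          Z.IsRun G pts net E η a₀ x₀ →
          ∀ T : ℕ, 2 ≤ T → S.R ≤ T →
            Z.payoffMin G pts E σstar 0 T - BayesGame.payoff G pts σstar
                ≤ C * (Real.log T / Real.sqrt T) ∧
            BayesGame.payoff G pts σstar - Z.payoffMax G pts E σstar 0 T
                ≤ C * (Real.log T / Real.sqrt T) ∧
            |Z.payoffMin G pts E σstar 1 T - BayesGame.payoff G pts σstar|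
                ≤ C * (Real.log T / Real.sqrt T) ∧
            |BayesGame.payoff G pts σstar - Z.payoffMax G pts E σstar 1 T|
                ≤ C * (Real.log T / Real.sqrt T) := by
  open BayesGame BayesGame.Trajectory in
  obtain ⟨ηbar, hηbar, hη⟩ := exists_isConsensusParam S
  refine ⟨ηbar, hηbar, fun G L pts net E η a₀ x₀ hG hD hnet hE hη0 hlt ha₀ _ => ?_⟩
  obtain ⟨C, -, hC⟩ := exists_gap_le hG hD hnet hE ha₀ (hη η hη0 hlt) x₀
  refine ⟨C, fun σstar Z hσ hZ T hT hRT => ?_⟩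
  -- Discarding a nonnegative penalty only helps the one-sided bounds, so they follow from the bound
  -- on the gap at `p` and `q`.
  have hpen : ∀ l x, 0 ≤ meanPenalty G E l x := fun l x => by
    have := (NNReal.coe_nonneg (L l l)).trans (hE l).le
    unfold meanPenalty penalty
    positivity
  have hbelow : ∀ f : ℕ → ℝ, BddBelow (f '' Set.Icc 1 (T / S.R)) := fun f =>
    ((Set.finite_Icc _ _).image f).bddBelow
  have habove : ∀ f : ℕ → ℝ, BddAbove (f '' Set.Icc 1 (T / S.R)) := fun f =>
    ((Set.finite_Icc _ _).image f).bddAbove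
  obtain ⟨p, hp, hgp⟩ := hC σstar Z hσ hZ T hT hRT 0
  obtain ⟨q, hq, hgq⟩ := hC σstar Z hσ hZ T hT hRT 1
  have hne : (Set.Icc 1 (T / S.R)).Nonempty := ⟨p, hp⟩
  have ep := payoff_add_penalty_sub (E := E) hD σstar (Z.avg 0 (p * S.R))
  have eq := payoff_sub_payoff_sub_penalty (E := E) hG hD σstar (Z.avg 1 (q * S.R))
  have min0 : Z.payoffMin G pts E σstar 0 T ≤ _ := csInf_le (hbelow _) (Set.mem_image_of_mem _ hp)
  have min1 : Z.payoffMin G pts E σstar 1 T ≤ _ := csInf_le (hbelow _) (Set.mem_image_of_mem _ hp)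
  have max0 : _ ≤ Z.payoffMax G pts E σstar 0 T := le_csSup (habove _) (Set.mem_image_of_mem _ hq)
  have max1 : _ ≤ Z.payoffMax G pts E σstar 1 T := le_csSup (habove _) (Set.mem_image_of_mem _ hq)
  -- Nonnegative gaps fix the signs inside the absolute values, here and in `high`.
  have low : BayesGame.payoff G pts σstar ≤ Z.payoffMin G pts E σstar 1 T := by
    refine le_csInf (hne.image _) ?_
    rintro _ ⟨k, -, rfl⟩
    have h1 := payoff_add_penalty_sub (E := E) hD σstar (Z.avg 0 (k * S.R))
    have h2 := gap_nonneg hG hD hE hσ 0 (Z.avg 0 (k * S.R))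
    simp only [one_mul]
    linarith
  have high : Z.payoffMax G pts E σstar 1 T ≤ BayesGame.payoff G pts σstar := by
    refine csSup_le (hne.image _) ?_
    rintro _ ⟨k, -, rfl⟩
    have h1 := payoff_sub_payoff_sub_penalty (E := E) hG hD σstar (Z.avg 1 (k * S.R))
    have h2 := gap_nonneg hG hD hE hσ 1 (Z.avg 1 (k * S.R))
    simp only [one_mul]
    linarith
  have hp0 := hpen 0 (Z.avg 0 (p * S.R))
  have hq0 := hpen 1 (Z.avg 1 (q * S.R))
  refine ⟨by linarith, by linarith, ?_, ?_⟩
  · rw [abs_of_nonneg (by linarith)]; linarith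
  · rw [abs_of_nonneg (by linarith)]; linarith
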